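/- Theorem (Alon, Krivelevich and Sudakov, 1998). For $S\subseteq\{1,\dots,n\}$ with $|S|=k$, let $W$ be the random symmetric $n\times n$ matrix whose entries $(W_{ij})_{i\le j}$ are independent, with $W_{ij}=+1$ if $i,j\in S$, and $W_{ij}$ uniform on $\{-1,+1\}$ otherwise. Distinct vertices $i,j$ are joined in the graph $G$ when $W_{ij}=+1$, so that $S$ is a hidden clique. A principal eigenvector of $W$ is a unit eigenvector for its largest eigenvalue. We say that a vector $v$ is accurate for $W$ if it is at Euclidean distance at most $1/100$ from some principal eigenvector of $W$; in particular, every exact principal eigenvector is accurate. We call $\hat S$ a spectral estimate built from $(W,v,k)$ if $\hat S$ consists of $k$ vertices with the largest number of neighbours (in $G$) in a set $B$ of $k$ indices at which $|v_i|$ is largest; ties are broken arbitrarily in both steps. Computations are carried out on a random access machine over $\mathbb{N}$ and $\mathbb{R}$ (exact arithmetic, comparisons and indirect addressing, with read-only access to $n$, $k$ and the entries of $W$), where every instruction and every test costs one step. Then there are a program $Q$ and a constant $C$ such that the following hold. 1. For all $n\ge1$, $0\le k\le n$, every symmetric $W\in\{-1,+1\}^{n\times n}$ and every $v\in\mathbb{R}^n$: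 started with $v$ in memory (and arbitrary contents in the rest of the memory), $Q$ halts after at most $Cn^2$ steps and outputs a spectral estimate built from $(W,v,k)$. 2. (Same complexity as computing the principal eigenvector.) Let $E$ be any program and $k\le n$. If, for every symmetric $W\in\{-1,+1\}^{n\times n}$, $E$ on input $(n,k,W)$ halts within $T$ steps and outputs an accurate vector for $W$, then the program "$E$, followed by $Q$" halts within $C\,T$ steps on all these inputs. 3. (Exact recovery.) For every $\varepsilon>0$ there is $N$ such that for all $n\ge N$ and all $S\subseteq\{1,\dots,n\}$ with $k=|S|>100\sqrt n$: with probability at least $1-\varepsilon$, every spectral estimate $\hat S$ built from $(W,v,k)$, with any accurate $v$ (in particular any exact principal eigenvector of $W$), equals $S$; and for every program $E$, the probability that "$E$, followed by $Q$" fails to output $S$ on input $(n,k,W)$ is at most $\varepsilon$ plus the probability that $E$ fails to output an accurate vector for $W$. -/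

import Mathlib

open MeasureTheory

noncomputable section

namespace HiddenClique

/-! ### The random matrix -/

instance {n : ℕ} : MeasurableSpace (Matrix (Fin n) (Fin n) ℝ) :=
  inferInstanceAs (MeasurableSpace (Fin n → Fin n → ℝ))

/-- The symmetric matrix with prescribed entries on and above the diagonal. -/
def symmetrize {n : ℕ} (z : {p : Fin n × Fin n // p.1 ≤ p.2} → ℝ) : Matrix (Fin n) (Fin n) ℝ :=
  Matrix.of fun i j => z ⟨(min i j, max i j), min_le_max⟩

/-- The law of the symmetric random matrix whose entries on and above the diagonal are
independent, with law `Q₁` at the positions in `S × S` and law `Q₀` elsewhere. -/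
def hiddenSubmatrixLaw (Q₀ Q₁ : Measure ℝ) {n : ℕ} (S : Finset (Fin n)) :
    Measure (Matrix (Fin n) (Fin n) ℝ) :=
  (Measure.pi fun p : {p : Fin n × Fin n // p.1 ≤ p.2} =>
    if p.1.1 ∈ S ∧ p.1.2 ∈ S then Q₁ else Q₀).map symmetrize

/-- The uniform law on `{-1, +1}`. -/
def signLaw : Measure ℝ :=
  (2⁻¹ : ENNReal) • Measure.dirac (-1) + (2⁻¹ : ENNReal) • Measure.dirac 1

/-- The law of `W` in the hidden clique problem with clique `S`. -/
def hiddenCliqueLaw {n : ℕ} (S : Finset (Fin n)) : Measure (Matrix (Fin n) (Fin n) ℝ) :=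
  hiddenSubmatrixLaw signLaw (Measure.dirac 1) S

instance : IsProbabilityMeasure signLaw :=
  ⟨by simp [signLaw, ENNReal.inv_two_add_inv_two]⟩

theorem measurable_symmetrize {n : ℕ} : Measurable (symmetrize (n := n)) :=
  measurable_pi_lambda _ fun _ => measurable_pi_lambda _ fun _ => measurable_pi_apply _

instance {n : ℕ} (S : Finset (Fin n)) : IsProbabilityMeasure (hiddenCliqueLaw S) := by
  have (p : {p : Fin n × Fin n // p.1 ≤ p.2}) : IsProbabilityMeasure
      (if p.1.1 ∈ S ∧ p.1.2 ∈ S then Measure.dirac (1 : ℝ) else signLaw) := by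
    split_ifs <;> infer_instance
  exact Measure.isProbabilityMeasure_map measurable_symmetrize.aemeasurable

/-- Symmetric matrices with entries in `{-1, +1}`: the possible inputs. -/
def IsSignMatrix {n : ℕ} (W : Matrix (Fin n) (Fin n) ℝ) : Prop :=
  W.IsSymm ∧ ∀ i j, W i j = 1 ∨ W i j = -1

/-! ### Principal eigenvectors -/

/-- `u` is a unit eigenvector of `W` for its largest eigenvalue. -/
def IsPrincipalEigenvector {n : ℕ} (W : Matrix (Fin n) (Fin n) ℝ)
    (u : EuclideanSpace ℝ (Fin n)) : Prop :=
  ‖u‖ = 1 ∧ ∃ l : ℝ, Module.End.HasEigenvector (Matrix.toEuclideanLin W) l u ∧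
    ∀ m : ℝ, Module.End.HasEigenvalue (Matrix.toEuclideanLin W) m → m ≤ l

/-- `v` is at Euclidean distance at most `δ` from a principal eigenvector of `W`. -/
def IsApproxPrincipalEigenvector (δ : ℝ) {n : ℕ} (W : Matrix (Fin n) (Fin n) ℝ)
    (v : EuclideanSpace ℝ (Fin n)) : Prop :=
  ∃ u, IsPrincipalEigenvector W u ∧ ‖v - u‖ ≤ δ

/-! ### The estimator -/

open Classical in
/-- The number of neighbours of `i` in `B`, in the graph in which distinct `i`, `j` are joined
if and only if `W i j = 1`. -/
def neighborCount {n : ℕ} (W : Matrix (Fin n) (Fin n) ℝ) (B : Finset (Fin n)) (i : Fin n) : ℕ :=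
  (B.filter fun j => j ≠ i ∧ W i j = 1).card

/-- `T` consists of `k` indices with the largest scores `f`; ties are broken arbitrarily. -/
def IsTopSet {n : ℕ} {α : Type*} [LE α] (f : Fin n → α) (k : ℕ) (T : Finset (Fin n)) : Prop :=
  T.card = k ∧ ∀ i ∈ T, ∀ j ∉ T, f j ≤ f i

/-- `T` consists of `k` vertices with the largest number of neighbours in a set `B` of
`k` vertices that carry the largest entries of `v` in absolute value. -/
def IsSpectralEstimate {n : ℕ} (W : Matrix (Fin n) (Fin n) ℝ) (v : EuclideanSpace ℝ (Fin n))
    (k : ℕ) (T : Finset (Fin n)) : Prop :=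
  ∃ B : Finset (Fin n), IsTopSet (fun i => |v i|) k B ∧ IsTopSet (neighborCount W B) k T

/-! ### Real random access machines

Programs have read-only access to `n`, `k` and the entries of `W`. They use natural-number
registers and real registers (addressed directly), and two unbounded memories, one for natural
numbers and one for real numbers (addressed through natural-number registers). Every instruction
and every test costs one step. -/

structure State where
  natReg : ℕ → ℕ
  realReg : ℕ → ℝ
  natMem : ℕ → ℕ
  realMem : ℕ → ℝ

/-- The state in which every program starts. -/
def State.zero : State := ⟨fun _ => 0, fun _ => 0, fun _ => 0, fun _ => 0⟩

inductive Instr where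
  | getN (i : ℕ)
  | getK (i : ℕ)
  | getEntry (x i j : ℕ)
  | setNat (i c : ℕ)
  | addNat (i j l : ℕ)
  | subNat (i j l : ℕ)
  | loadNat (i j : ℕ)
  | storeNat (i j : ℕ)
  | setReal (x : ℕ) (c : ℤ)
  | addReal (x y z : ℕ)
  | subReal (x y z : ℕ)
  | mulReal (x y z : ℕ)
  | divReal (x y z : ℕ)
  | loadReal (x i : ℕ)
  | storeReal (i x : ℕ)

def State.putNat (s : State) (i a : ℕ) : State :=
  { s with natReg := Function.update s.natReg i a }

def State.putReal (s : State) (x : ℕ) (a : ℝ) : State :=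
  { s with realReg := Function.update s.realReg x a }

/-- The entry of `W` at given indices (`0` if they are out of range). -/
def entry {n : ℕ} (W : Matrix (Fin n) (Fin n) ℝ) (i j : ℕ) : ℝ :=
  if h : i < n ∧ j < n then W ⟨i, h.1⟩ ⟨j, h.2⟩ else 0

/-- The effect of an instruction. -/
def Instr.apply {n : ℕ} (k : ℕ) (W : Matrix (Fin n) (Fin n) ℝ) (s : State) : Instr → State
  | getN i => s.putNat i n
  | getK i => s.putNat i k
  | getEntry x i j => s.putReal x (entry W (s.natReg i) (s.natReg j))
  | setNat i c => s.putNat i c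
  | addNat i j l => s.putNat i (s.natReg j + s.natReg l)
  | subNat i j l => s.putNat i (s.natReg j - s.natReg l)
  | loadNat i j => s.putNat i (s.natMem (s.natReg j))
  | storeNat i j => { s with natMem := Function.update s.natMem (s.natReg i) (s.natReg j) }
  | setReal x c => s.putReal x c
  | addReal x y z => s.putReal x (s.realReg y + s.realReg z)
  | subReal x y z => s.putReal x (s.realReg y - s.realReg z)
  | mulReal x y z => s.putReal x (s.realReg y * s.realReg z)
  | divReal x y z => s.putReal x (s.realReg y / s.realReg z)
  | loadReal x i => s.putReal x (s.realMem (s.natReg i))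
  | storeReal i x => { s with realMem := Function.update s.realMem (s.natReg i) (s.realReg x) }

/-- The tests: `<` between two natural-number registers or between two real registers. -/
inductive Test where
  | ltNat (i j : ℕ)
  | ltReal (x y : ℕ)

def Test.holds (s : State) : Test → Prop
  | ltNat i j => s.natReg i < s.natReg j
  | ltReal x y => s.realReg x < s.realReg y

/-- Programs: instructions, composition, branching and while-loops. -/
inductive Program where
  | instr (a : Instr)
  | seq (p q : Program)
  | branch (b : Test) (p q : Program)
  | loop (b : Test) (p : Program)

/-- `Exec k W p s t s'`: on the input `(n, k, W)`, the program `p` started in the state `s`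
halts after exactly `t` steps in the state `s'`. -/
inductive Exec {n : ℕ} (k : ℕ) (W : Matrix (Fin n) (Fin n) ℝ) :
    Program → State → ℕ → State → Prop where
  | instr (a : Instr) (s : State) : Exec k W (.instr a) s 1 (a.apply k W s)
  | seq {p q : Program} {s s' s'' : State} {t t' : ℕ} :
      Exec k W p s t s' → Exec k W q s' t' s'' → Exec k W (.seq p q) s (t + t') s''
  | branch_true {b : Test} {p q : Program} {s s' : State} {t : ℕ} :
      b.holds s → Exec k W p s t s' → Exec k W (.branch b p q) s (1 + t) s'
  | branch_false {b : Test} {p q : Program} {s s' : State} {t : ℕ} :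
      ¬ b.holds s → Exec k W q s t s' → Exec k W (.branch b p q) s (1 + t) s'
  | loop_true {b : Test} {p : Program} {s s' s'' : State} {t t' : ℕ} :
      b.holds s → Exec k W p s t s' → Exec k W (.loop b p) s' t' s'' →
        Exec k W (.loop b p) s (1 + t + t') s''
  | loop_false {b : Test} {p : Program} {s : State} :
      ¬ b.holds s → Exec k W (.loop b p) s 1 s

/-- The output read as a vector: the first `n` cells of the real memory. -/
def State.vec (n : ℕ) (s : State) : EuclideanSpace ℝ (Fin n) :=
  WithLp.toLp 2 fun i => s.realMem i

/-- The output read as a set: the indices of the cells among the first `n` cells of the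
natural-number memory that hold a `1`. -/
def State.set (n : ℕ) (s : State) : Finset (Fin n) :=
  Finset.univ.filter fun i => s.natMem i = 1

/-- On the input `(n, k, W)`, `p` halts and outputs a vector at distance at most `1 / 100`
from a principal eigenvector of `W`. -/
def ComputesEigenvector {n : ℕ} (k : ℕ) (W : Matrix (Fin n) (Fin n) ℝ) (p : Program) : Prop :=
  ∃ t s, Exec k W p State.zero t s ∧ IsApproxPrincipalEigenvector (1 / 100) W (s.vec n)

/-- On the input `(n, k, W)`, `p` halts and outputs the set `T`. -/
def OutputsSet {n : ℕ} (k : ℕ) (W : Matrix (Fin n) (Fin n) ℝ) (p : Program)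
    (T : Finset (Fin n)) : Prop :=
  ∃ t s, Exec k W p State.zero t s ∧ s.set n = T

/-- On every input `(n, k, W)` with `W` a symmetric sign matrix of size `n`, `p` halts after at
most `T` steps. -/
def RunsInTime (n k : ℕ) (p : Program) (T : ℕ) : Prop :=
  ∀ W : Matrix (Fin n) (Fin n) ℝ, IsSignMatrix W → ∃ t s, Exec k W p State.zero t s ∧ t ≤ T

end HiddenClique

end

/-! Recovery. On `S × S` the matrix is identically one, so `W` is the rank-one matrix `1_S 1_Sᵀ`,
with eigenvalue `k`, plus the mean-zero part `Z = offBlock S W`. With high probability `‖Z‖ ≤ 20√n <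
k/5`, and then every principal eigenvector lies within `0.21` of `1_S/√k` up to sign
(`IsPrincipalEigenvector.exists_dist_indicator_le`). The `k` largest entries of an accurate vector
therefore miss at most `k/10` vertices of `S`. A vertex of `S` keeps at least `9k/10 - 1` neighbours
in `B`. A vertex outside has at most `8k/10`, since with high probability it has at most `7k/10`
neighbours in `S`. This gap gives `IsSpectralEstimate.eq_clique`. The two events concern `W` alone
and the deduction is deterministic, so the dependence of `v` on `W` is harmless.

Both events follow from one sub-Gaussian tail bound for linear forms in the entries
(`hiddenCliqueLaw_le_exp`) and a union bound; for the norm, the union runs over pairs of points of a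
`1/4`-net of the unit ball.

Complexity. Ranking the entries and counting neighbours by nested loops takes `O(n^2)` steps
(`haltsWithin_cleanup`). This is absorbed in the time of `E` because `E` itself needs order `n^2`
steps (`sq_le_of_computesEigenvector`). A run on the all-ones matrix that reads few entries is
unchanged if all unread entries become `-1`, but the two matrices have no principal eigenvectors
close to each other. -/

namespace HiddenClique

/-! ### Running programs -/

section Programs

variable {n k : ℕ} {W : Matrix (Fin n) (Fin n) ℝ}

/-- On the input `(n, k, W)`, the program `p` started in the state `s` halts after at most `c`
steps, in a state that satisfies `Q`. -/
def HaltsWithin {n : ℕ} (k : ℕ) (W : Matrix (Fin n) (Fin n) ℝ) (p : Program) (s : State) (c : ℕ)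
    (Q : State → Prop) : Prop :=
  ∃ t s', Exec k W p s t s' ∧ t ≤ c ∧ Q s'

theorem HaltsWithin.mono {p : Program} {s : State} {c d : ℕ} {Q R : State → Prop}
    (h : HaltsWithin k W p s c Q) (hcd : c ≤ d) (hQR : ∀ s, Q s → R s) :
    HaltsWithin k W p s d R := by
  obtain ⟨t, s', he, ht, hQ⟩ := h
  exact ⟨t, s', he, ht.trans hcd, hQR _ hQ⟩

theorem HaltsWithin.instr {a : Instr} {s : State} {Q : State → Prop} (h : Q (a.apply k W s)) :
    HaltsWithin k W (.instr a) s 1 Q :=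
  ⟨1, _, .instr a s, le_rfl, h⟩

/-- The postcondition for `p` is the halting statement for `q`, so a goal about a program unfolds
one instruction at a time, as with weakest preconditions. -/
theorem HaltsWithin.seq {p q : Program} {s : State} {c d : ℕ} {Q : State → Prop}
    (h : HaltsWithin k W p s c fun s' => HaltsWithin k W q s' d Q) :
    HaltsWithin k W (p.seq q) s (c + d) Q := by
  obtain ⟨t, s', he, ht, t', s'', he', ht', hQ⟩ := h
  exact ⟨t + t', s'', he.seq he', add_le_add ht ht', hQ⟩

theorem HaltsWithin.instr_seq {a : Instr} {q : Program} {s : State} {d : ℕ} {Q : State → Prop}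
    (h : HaltsWithin k W q (a.apply k W s) d Q) :
    HaltsWithin k W ((Program.instr a).seq q) s (1 + d) Q :=
  (HaltsWithin.instr (Q := fun s' => HaltsWithin k W q s' d Q) h).seq

theorem HaltsWithin.branch {b : Test} {p q : Program} {s : State} {c : ℕ} {Q : State → Prop}
    (hp : b.holds s → HaltsWithin k W p s c Q) (hq : ¬ b.holds s → HaltsWithin k W q s c Q) :
    HaltsWithin k W (.branch b p q) s (1 + c) Q := by
  by_cases hb : b.holds s
  · obtain ⟨t, s', he, ht, hQ⟩ := hp hb
    exact ⟨1 + t, s', .branch_true hb he, by omega, hQ⟩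
  · obtain ⟨t, s', he, ht, hQ⟩ := hq hb
    exact ⟨1 + t, s', .branch_false hb he, by omega, hQ⟩

/-- Run `p` for the values `0, 1, …` of the register `i`, below the bound in register `b`;
the register `o` holds the number `1`. -/
def Program.forLoop (i b o : ℕ) (p : Program) : Program :=
  (Program.instr (.setNat i 0)).seq (.loop (.ltNat i b) (p.seq (.instr (.addNat i i o))))

/-- Induction on the number of remaining rounds, with invariant `I`. Each round costs the body plus
a test and an increment; the two extra steps are the initialisation and the last, failing test. -/
theorem HaltsWithin.forLoop {i b o N c : ℕ} {p : Program} {s : State} (I : ℕ → State → Prop)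
    (hreg : ∀ m s, I m s → s.natReg i = m ∧ s.natReg b = N)
    (hzero : I 0 ((Instr.setNat i 0).apply k W s))
    (hstep : ∀ m s, m < N → I m s →
      HaltsWithin k W p s c fun s' => I (m + 1) ((Instr.addNat i i o).apply k W s')) :
    HaltsWithin k W (.forLoop i b o p) s (1 + (N * (c + 2) + 1)) (I N) := by
  refine HaltsWithin.instr_seq ?_
  have key : ∀ d m s, m + d = N → I m s →
      HaltsWithin k W (.loop (.ltNat i b) (p.seq (.instr (.addNat i i o)))) s
        (d * (c + 2) + 1) (I N) := by
    intro d
    induction d with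
    | zero =>
      intro m s hm hI
      obtain rfl : m = N := by omega
      obtain ⟨h1, h2⟩ := hreg _ _ hI
      exact ⟨1, s, .loop_false (by simp [Test.holds, h1, h2]), by omega, hI⟩
    | succ d ih =>
      intro m s hm hI
      obtain ⟨h1, h2⟩ := hreg _ _ hI
      obtain ⟨t, s', he, ht, hI'⟩ := hstep m s (by omega) hI
      obtain ⟨t', s'', he', ht', hI''⟩ := ih (m + 1) _ (by omega) hI'
      refine ⟨1 + (t + 1) + t', s'', .loop_true (by simp [Test.holds, h1, h2]; omega)
        (he.seq (.instr _ _)) he', ?_, hI''⟩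
      rw [Nat.succ_mul]
      omega
  exact key N 0 _ (by omega) hzero

/-! ### The program that builds the spectral estimate -/

/-- Store the input sizes and constants in registers. -/
def setup : Program :=
  (Program.instr (.getN 0)).seq <| (Program.instr (.getK 1)).seq <|
  (Program.instr (.setNat 2 1)).seq <| (Program.instr (.setNat 3 0)).seq <|
  (Program.instr (.setReal 2 0)).seq <| Program.instr (.setReal 3 1)

/-- The contents of the registers after `setup`. -/
def IsSetUp (n k : ℕ) (s : State) : Prop :=
  s.natReg 0 = n ∧ s.natReg 1 = k ∧ s.natReg 2 = 1 ∧ s.natReg 3 = 0 ∧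
    s.realReg 2 = 0 ∧ s.realReg 3 = 1

/-- Replace the first `n` cells of the real memory by their absolute values. -/
def absLoop : Program :=
  .forLoop 4 0 2 <| (Program.instr (.loadReal 0 4)).seq <|
    -- Register `3` already holds `0`, so `setNat 3 0` acts as a skip, here and in the loops below.
    (Program.branch (.ltReal 0 2) (.instr (.subReal 0 2 0)) (.instr (.setNat 3 0))).seq <|
    Program.instr (.storeReal 4 0)

/-- Mark the indices below `n` of the `k` largest cells of the real memory. -/
def selectLoop : Program :=
  .forLoop 4 0 2 <| (Program.instr (.loadReal 0 4)).seq <| (Program.instr (.setNat 6 0)).seq <|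
    (Program.forLoop 5 0 2 <| (Program.instr (.loadReal 1 5)).seq <|
      .branch (.ltReal 0 1) (.instr (.addNat 6 6 2)) <|
      .branch (.ltReal 1 0) (.instr (.setNat 3 0)) <|
      -- Reached only when the two values are equal: the smaller index comes first.
      .branch (.ltNat 5 4) (.instr (.addNat 6 6 2)) (.instr (.setNat 3 0))).seq <|
    .branch (.ltNat 6 1) (.instr (.storeNat 4 2)) (.instr (.storeNat 4 3))

/-- Store in the real memory the numbers of marked neighbours of the indices below `n`. -/
def countLoop : Program :=
  .forLoop 4 0 2 <| (Program.instr (.setReal 0 0)).seq <|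
    (Program.forLoop 5 0 2 <| (Program.instr (.loadNat 6 5)).seq <|
      (Program.instr (.getEntry 1 4 5)).seq <|
      .branch (.ltNat 3 6)
        (.branch (.ltReal 2 1)
          (.branch (.ltNat 4 5) (.instr (.addReal 0 0 3))
            (.branch (.ltNat 5 4) (.instr (.addReal 0 0 3)) (.instr (.setNat 3 0))))
          (.instr (.setNat 3 0)))
        (.instr (.setNat 3 0))).seq <|
    Program.instr (.storeReal 4 0)

/-- Compute a spectral estimate from the vector in the real memory. -/
def cleanup : Program :=
  setup.seq <| absLoop.seq <| selectLoop.seq <| countLoop.seq selectLoop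

/-! ### Invariants and running times of the phases -/

theorem haltsWithin_setup (s : State) :
    HaltsWithin k W setup s 6 fun s' => IsSetUp n k s' ∧ s'.realMem = s.realMem := by
  refine .mono (c := 1 + (1 + (1 + (1 + (1 + 1))))) (Q := fun s' => IsSetUp n k s' ∧
    s'.realMem = s.realMem) ?_ (by norm_num) (fun _ h => h)
  iterate 5 refine HaltsWithin.instr_seq ?_
  refine HaltsWithin.instr ?_
  simp [IsSetUp, Instr.apply, State.putNat, State.putReal, Function.update]

theorem haltsWithin_absLoop {s : State} (hs : IsSetUp n k s) :
    HaltsWithin k W absLoop s (1 + (n * (4 + 2) + 1)) fun s' =>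
      IsSetUp n k s' ∧ ∀ i < n, s'.realMem i = |s.realMem i| := by
  refine .mono (HaltsWithin.forLoop (c := 1 + ((1 + 1) + 1)) (N := n)
    (fun m s' => IsSetUp n k s' ∧ s'.natReg 4 = m ∧
      ∀ i, s'.realMem i = if i < m then |s.realMem i| else s.realMem i) ?_ ?_ ?_) le_rfl ?_
  · rintro m s' ⟨hs', hm, -⟩
    exact ⟨hm, hs'.1⟩
  · simpa [IsSetUp, Instr.apply, State.putNat, Function.update] using hs
  · rintro m s' hmn ⟨⟨h0, h1, h2, h3, h4, h5⟩, hm, hmem⟩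
    have key (i : ℕ) (a : ℝ) (ha : a = |s.realMem m|) : (if i = m then a else s'.realMem i) =
        if i ≤ m then |s.realMem i| else s.realMem i := by
      rcases lt_trichotomy i m with h | rfl | h
      · simp [hmem, h.ne, h, h.le]
      · simp [ha]
      · simp [hmem, h.ne', h.not_gt, h.not_ge]
    refine HaltsWithin.instr_seq (HaltsWithin.seq (HaltsWithin.branch ?_ ?_)) <;> intro hb <;>
      refine HaltsWithin.instr (HaltsWithin.instr ?_) <;>
      simp only [Instr.apply, State.putReal, Test.holds, Function.update, hm, hmem, h4] at hb <;>
      simp [IsSetUp, Instr.apply, State.putReal, State.putNat, Function.update, h0, h1, h2, h3, h4,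
        h5, hm] <;> intro i <;> simp at hb
    · exact key i _ (by simp [hmem, abs_of_neg hb])
    · rw [← key i (s'.realMem m) (by simp [hmem, abs_of_nonneg hb])]
      split_ifs with h
      exacts [h ▸ rfl, rfl]
  · rintro s' ⟨hs', -, h⟩
    exact ⟨hs', fun i hi => by simp [h, hi]⟩

open Classical in
/-- The number of indices below `m` that come before `i` when the values of `f` are sorted in
decreasing order, equal values being sorted by index. -/
noncomputable def rankBelow (f : ℕ → ℝ) (m i : ℕ) : ℕ :=
  ((Finset.range m).filter fun j => f i < f j ∨ (f j = f i ∧ j < i)).card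

theorem rankBelow_succ_of_pos {f : ℕ → ℝ} {m i : ℕ} (h : f i < f m ∨ (f m = f i ∧ m < i)) :
    rankBelow f (m + 1) i = rankBelow f m i + 1 := by
  rw [rankBelow, Finset.range_add_one, Finset.filter_insert, if_pos h,
    Finset.card_insert_of_notMem (by simp), rankBelow]

theorem rankBelow_succ_of_neg {f : ℕ → ℝ} {m i : ℕ} (h : ¬ (f i < f m ∨ (f m = f i ∧ m < i))) :
    rankBelow f (m + 1) i = rankBelow f m i := by
  rw [rankBelow, Finset.range_add_one, Finset.filter_insert, if_neg h, rankBelow]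

/-- Selection by counting instead of sorting: after `l` inner rounds, register `6` holds the rank of
the current index among the first `l` cells. The real memory is never written, so all ranks refer to
the same values. -/
theorem haltsWithin_selectLoop {s : State} (hs : IsSetUp n k s) :
    HaltsWithin k W selectLoop s (1 + (n * ((n * 7 + 6) + 2) + 1)) fun s' =>
      IsSetUp n k s' ∧ ∀ i < n, s'.natMem i = if rankBelow s.realMem n i < k then 1 else 0 := by
  refine .mono (HaltsWithin.forLoop
    (c := 1 + (1 + ((1 + (n * ((1 + (1 + (1 + (1 + 1)))) + 2) + 1)) + (1 + 1)))) (N := n)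
    (fun m s' => IsSetUp n k s' ∧ s'.natReg 4 = m ∧ s'.realMem = s.realMem ∧
      ∀ i < m, s'.natMem i = if rankBelow s.realMem n i < k then 1 else 0) ?_ ?_ ?_) ?_ ?_
  · rintro m s' ⟨hs', hm, -⟩
    exact ⟨hm, hs'.1⟩
  · simpa [IsSetUp, Instr.apply, State.putNat, Function.update] using hs
  · rintro m s' hmn ⟨⟨h0, h1, h2, h3, h4, h5⟩, hm, hf, hmem⟩
    refine HaltsWithin.instr_seq (HaltsWithin.instr_seq (HaltsWithin.seq
      (.mono (HaltsWithin.forLoop (N := n) (c := 1 + (1 + (1 + (1 + 1))))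
        (fun l s'' => IsSetUp n k s'' ∧ s''.natReg 4 = m ∧
        s''.realMem = s.realMem ∧ s''.natMem = s'.natMem ∧ s''.realReg 0 = s.realMem m ∧
        s''.natReg 5 = l ∧ s''.natReg 6 = rankBelow s.realMem l m) ?_ ?_ ?_) le_rfl ?_)))
    · rintro l s'' ⟨hs'', -, -, -, -, hl, -⟩
      exact ⟨hl, hs''.1⟩
    · simp [IsSetUp, Instr.apply, State.putNat, State.putReal, Function.update, h0, h1, h2, h3, h4,
        h5, hm, hf, rankBelow]
    · rintro l s'' hl ⟨⟨h0, h1, h2, h3, h4, h5⟩, hm, hf, hg, hx, h5', h6⟩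
      refine HaltsWithin.instr_seq (HaltsWithin.branch ?_ fun ha => HaltsWithin.branch ?_ fun hb =>
        HaltsWithin.branch ?_ ?_) <;> intro hc <;>
        refine .mono (HaltsWithin.instr ?_) (by norm_num) (fun _ h => h) <;>
        simp [IsSetUp, Instr.apply, State.putNat, State.putReal, Function.update, h0, h1, h2, h3,
          h4, h5, hm, hf, hg, hx, h5', h6] <;>
        simp [Instr.apply, State.putReal, Test.holds, Function.update, hm, hx, hf, h5'] at * <;>
        first
          | rw [rankBelow_succ_of_pos]; grind
          | rw [rankBelow_succ_of_neg]; grind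
    · rintro s'' ⟨⟨h0, h1, h2, h3, h4, h5⟩, hm, hf, hg, hx, h5', h6⟩
      refine HaltsWithin.branch ?_ ?_ <;> intro hb <;> refine HaltsWithin.instr ?_ <;>
        simp only [Test.holds, h6, h1] at hb <;>
        simp [IsSetUp, Instr.apply, State.putNat, Function.update, h0, h1, h2, h3, h4, h5, hm, hf,
          hg] <;> intro i hi <;> split_ifs with h
      all_goals grind
  · exact le_of_eq (by ring)
  · rintro s' ⟨hs', -, -, h⟩
    exact ⟨hs', h⟩

open Classical in
/-- The number of indices `j < m` with `0 < g j` that are joined to `i`. -/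
noncomputable def countBelow {n : ℕ} (W : Matrix (Fin n) (Fin n) ℝ) (g : ℕ → ℕ) (m i : ℕ) : ℕ :=
  ((Finset.range m).filter fun j => 0 < g j ∧ 0 < entry W i j ∧ i ≠ j).card

theorem countBelow_succ_of_pos {g : ℕ → ℕ} {m i : ℕ} (h : 0 < g m ∧ 0 < entry W i m ∧ i ≠ m) :
    countBelow W g (m + 1) i = countBelow W g m i + 1 := by
  rw [countBelow, Finset.range_add_one, Finset.filter_insert, if_pos h,
    Finset.card_insert_of_notMem (by simp), countBelow]

theorem countBelow_succ_of_neg {g : ℕ → ℕ} {m i : ℕ} (h : ¬ (0 < g m ∧ 0 < entry W i m ∧ i ≠ m)) :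
    countBelow W g (m + 1) i = countBelow W g m i := by
  rw [countBelow, Finset.range_add_one, Finset.filter_insert, if_neg h, countBelow]

theorem haltsWithin_countLoop {s : State} (hs : IsSetUp n k s) :
    HaltsWithin k W countLoop s (1 + (n * ((n * 9 + 4) + 2) + 1)) fun s' =>
      IsSetUp n k s' ∧ ∀ i < n, s'.realMem i = countBelow W s.natMem n i := by
  refine .mono (HaltsWithin.forLoop
    (c := 1 + ((1 + (n * ((1 + (1 + (1 + (1 + (1 + (1 + 1)))))) + 2) + 1)) + 1)) (N := n)
    (fun m s' => IsSetUp n k s' ∧ s'.natReg 4 = m ∧ s'.natMem = s.natMem ∧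
      ∀ i < m, s'.realMem i = countBelow W s.natMem n i) ?_ ?_ ?_) ?_ ?_
  · rintro m s' ⟨hs', hm, -⟩
    exact ⟨hm, hs'.1⟩
  · simpa [IsSetUp, Instr.apply, State.putNat, Function.update] using hs
  · rintro m s' hmn ⟨⟨h0, h1, h2, h3, h4, h5⟩, hm, hf, hmem⟩
    refine HaltsWithin.instr_seq (HaltsWithin.seq
      (.mono (HaltsWithin.forLoop (N := n) (c := 1 + (1 + (1 + (1 + (1 + (1 + 1))))))
        (fun l s'' => IsSetUp n k s'' ∧ s''.natReg 4 = m ∧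
        s''.natMem = s.natMem ∧ s''.realMem = s'.realMem ∧
        s''.natReg 5 = l ∧ s''.realReg 0 = countBelow W s.natMem l m) ?_ ?_ ?_) le_rfl ?_))
    · rintro l s'' ⟨hs'', -, -, -, hl, -⟩
      exact ⟨hl, hs''.1⟩
    · simp [IsSetUp, Instr.apply, State.putNat, State.putReal, Function.update, h0, h1, h2, h3, h4,
        h5, hm, hf, countBelow]
    · rintro l s'' hl ⟨⟨h0, h1, h2, h3, h4, h5⟩, hm, hf, hg, h5', h6⟩
      refine HaltsWithin.instr_seq (HaltsWithin.instr_seq (HaltsWithin.branch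
        (fun ha => HaltsWithin.branch (fun hb => HaltsWithin.branch ?_ fun hd =>
          HaltsWithin.branch ?_ ?_) ?_) ?_)) <;> intro hc <;>
        refine .mono (HaltsWithin.instr ?_) (by norm_num) (fun _ h => h) <;>
        simp [IsSetUp, Instr.apply, State.putNat, State.putReal, Function.update, h0, h1, h2, h3,
          h4, h5, hm, hf, hg, h5', h6] <;>
        simp [Instr.apply, State.putReal, State.putNat, Test.holds, Function.update, hm, hf, h5',
          h3, h4] at * <;>
        first
          | rw [countBelow_succ_of_pos (by grind)]; push_cast; rfl
          | rw [countBelow_succ_of_neg]; grind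
    · rintro s'' ⟨⟨h0, h1, h2, h3, h4, h5⟩, hm, hf, hg, h5', h6⟩
      refine HaltsWithin.instr ?_
      simp [IsSetUp, Instr.apply, State.putNat, Function.update, h0, h1, h2, h3, h4, h5, hm, hf,
          hg]
      intro i hi
      split_ifs with h
      all_goals grind
  · exact le_of_eq (by ring)
  · rintro s' ⟨hs', -, -, h⟩
    exact ⟨hs', h⟩

/-! ### Correctness of the selection and of the neighbour counts -/

theorem rankBelow_le_of_lt {f : ℕ → ℝ} {m i j : ℕ} (h : f i < f j) :
    rankBelow f m j ≤ rankBelow f m i := by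
  refine Finset.card_le_card fun l hl => ?_
  simp only [Finset.mem_filter] at hl ⊢
  refine ⟨hl.1, .inl ?_⟩
  rcases hl.2 with h' | h'
  · exact h.trans h'
  · rw [h'.1]
    exact h

theorem rankBelow_lt_rankBelow {f : ℕ → ℝ} {m i j : ℕ} (hj : j < m)
    (h : f i < f j ∨ (f j = f i ∧ j < i)) : rankBelow f m j < rankBelow f m i := by
  refine Finset.card_lt_card ((Finset.ssubset_iff_of_subset fun l hl => ?_).2 ⟨j, ?_, ?_⟩)
  · simp only [Finset.mem_filter] at hl ⊢
    refine ⟨hl.1, ?_⟩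
    grind
  · simpa [hj] using h
  · simp

/-- Breaking ties by index makes the order strict and total, so the rank is an injection of `Fin n`
into itself, hence a bijection, and exactly `k` indices have rank below `k`. -/
theorem isTopSet_rankBelow (f : ℕ → ℝ) (hk : k ≤ n) :
    IsTopSet (fun i : Fin n => f i) k (Finset.univ.filter fun i : Fin n => rankBelow f n i < k) := by
  constructor
  · have hlt (i : Fin n) : rankBelow f n i < n := by
      refine (Finset.card_lt_card (t := Finset.range n) ?_).trans_eq (Finset.card_range n)
      exact (Finset.ssubset_iff_of_subset (Finset.filter_subset _ _)).2
        ⟨i, Finset.mem_range.2 i.2, by simp⟩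
    have hinj : Function.Injective fun i : Fin n => (⟨rankBelow f n i, hlt i⟩ : Fin n) := by
      intro i j hij
      by_contra hne
      have hne' : (i : ℕ) ≠ j := fun h => hne (Fin.ext h)
      have hij' : rankBelow f n i = rankBelow f n j := congrArg Fin.val hij
      by_cases h : f i < f j ∨ (f j = f i ∧ (j : ℕ) < i)
      · exact (rankBelow_lt_rankBelow j.2 h).ne hij'.symm
      · exact (rankBelow_lt_rankBelow (j := i) i.2 (by grind)).ne hij'
    let e := Equiv.ofBijective _ (Finite.injective_iff_bijective.1 hinj)
    have : (Finset.univ.filter fun i : Fin n => rankBelow f n i < k).map e.toEmbedding =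
        Finset.univ.filter fun x : Fin n => (x : ℕ) < k := by
      ext x
      obtain ⟨i, rfl⟩ := e.surjective x
      simp [e]
    rw [← Finset.card_map e.toEmbedding, this, Fin.card_filter_val_lt, min_eq_right hk]
  · intro i hi j hj
    simp only [Finset.mem_filter, Finset.mem_univ, true_and, not_lt] at hi hj
    by_contra! h
    exact absurd (rankBelow_le_of_lt (m := n) h) (by omega)

/-- The machine tests only `<`; for marks in `{0, 1}` and entries in `{-1, 1}`, positivity is the
same as being `1`. -/
theorem countBelow_eq_neighborCount {n : ℕ} {W : Matrix (Fin n) (Fin n) ℝ} (hW : IsSignMatrix W)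
    {g : ℕ → ℕ} (hg : ∀ i < n, g i = 0 ∨ g i = 1) (i : Fin n) :
    countBelow W g n i = neighborCount W (Finset.univ.filter fun j : Fin n => g j = 1) i := by
  rw [countBelow, neighborCount, Finset.card_filter, ← Fin.sum_univ_eq_sum_range
    (fun j => if 0 < g j ∧ 0 < entry W i j ∧ (i : ℕ) ≠ j then 1 else 0), ← Finset.card_filter,
    Finset.filter_filter]
  congr 1
  ext j
  have h1 : 0 < g j ↔ g j = 1 := by
    have := hg j j.2
    omega
  have h2 : 0 < entry W i j ↔ W i j = 1 := by
    rcases hW.2 i j with h | h <;> simp [entry, h]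
    norm_num
  have h3 : (i : ℕ) ≠ j ↔ j ≠ i := by
    rw [Ne, Fin.val_inj, ne_comm]
  simp only [Finset.mem_filter, Finset.mem_univ, true_and, h1, h2, h3]
  tauto

theorem haltsWithin_cleanup (hn : 1 ≤ n) (hk : k ≤ n) (hW : IsSignMatrix W) (s : State) :
    HaltsWithin k W cleanup s (70 * n ^ 2) fun s' =>
      IsSpectralEstimate W (s.vec n) k (s'.set n) := by
  refine .mono (.seq <| (haltsWithin_setup s).mono le_rfl fun s₁ h₁ =>
    .seq <| (haltsWithin_absLoop h₁.1).mono le_rfl fun s₂ h₂ =>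
    .seq <| (haltsWithin_selectLoop h₂.1).mono le_rfl fun s₃ h₃ =>
    .seq <| (haltsWithin_countLoop h₃.1).mono le_rfl fun s₄ h₄ =>
    (haltsWithin_selectLoop h₄.1).mono le_rfl fun s₅ h₅ =>
    (?_ : IsSpectralEstimate W (s.vec n) k (s₅.set n))) ?_ (fun _ h => h)
  · have hset (f : ℕ → ℝ) (t : State)
        (ht : ∀ i < n, t.natMem i = if rankBelow f n i < k then 1 else 0) :
        IsTopSet (fun i : Fin n => f i) k (t.set n) := by
      convert isTopSet_rankBelow f hk using 1
      ext i
      simp [State.set, ht i i.2]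
    refine ⟨s₃.set n, ?_, ?_⟩
    · convert hset _ s₃ h₃.2 using 2 with i
      rw [h₂.2 i i.2, h₁.2]
      rfl
    · obtain ⟨hcard, htop⟩ := hset _ s₅ h₅.2
      refine ⟨hcard, fun i hi j hj => ?_⟩
      have := htop i hi j hj
      simp only [h₄.2 _ (Fin.is_lt _)] at this
      have hg : ∀ i < n, s₃.natMem i = 0 ∨ s₃.natMem i = 1 := fun i hi => by
        rw [h₃.2 i hi]
        split_ifs <;> simp
      rw [countBelow_eq_neighborCount hW hg, countBelow_eq_neighborCount hW hg] at this
      exact_mod_cast this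
  -- The five phases take at most `23 * n ^ 2 + 28 * n + 14` steps together, and `1 ≤ n`.
  · nlinarith

end Programs

/-! ### Determinism and the number of queries -/

theorem Exec.deterministic {n k : ℕ} {W : Matrix (Fin n) (Fin n) ℝ} {p : Program}
    {s s₁ s₂ : State} {t₁ t₂ : ℕ} (h₁ : Exec k W p s t₁ s₁) (h₂ : Exec k W p s t₂ s₂) :
    t₁ = t₂ ∧ s₁ = s₂ := by
  induction h₁ generalizing t₂ s₂ with
  | instr a s =>
    cases h₂
    exact ⟨rfl, rfl⟩
  | seq _ _ ih ih' =>
    cases h₂ with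
    | seq h h' =>
      obtain ⟨rfl, rfl⟩ := ih h
      obtain ⟨rfl, rfl⟩ := ih' h'
      exact ⟨rfl, rfl⟩
  | branch_true hb _ ih =>
    cases h₂ with
    | branch_true _ h =>
      obtain ⟨rfl, rfl⟩ := ih h
      exact ⟨rfl, rfl⟩
    | branch_false hb' _ => exact absurd hb hb'
  | branch_false hb _ ih =>
    cases h₂ with
    | branch_true hb' _ => exact absurd hb' hb
    | branch_false _ h =>
      obtain ⟨rfl, rfl⟩ := ih h
      exact ⟨rfl, rfl⟩
  | loop_true hb _ _ ih ih' =>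
    cases h₂ with
    | loop_true _ h h' =>
      obtain ⟨rfl, rfl⟩ := ih h
      obtain ⟨rfl, rfl⟩ := ih' h'
      exact ⟨rfl, rfl⟩
    | loop_false hb' => exact absurd hb hb'
  | loop_false hb =>
    cases h₂ with
    | loop_true hb' _ _ => exact absurd hb' hb
    | loop_false _ => exact ⟨rfl, rfl⟩

theorem Exec.one_le {n k : ℕ} {W : Matrix (Fin n) (Fin n) ℝ} {p : Program} {s s' : State} {t : ℕ}
    (h : Exec k W p s t s') : 1 ≤ t := by
  induction h <;> omega

/-- A run of `t` steps depends on at most `t` entries of the input matrix. -/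
theorem Exec.exists_queries {n k : ℕ} {W : Matrix (Fin n) (Fin n) ℝ} {p : Program}
    {s s' : State} {t : ℕ} (h : Exec k W p s t s') :
    ∃ R : Finset (Fin n × Fin n), R.card ≤ t ∧ ∀ W' : Matrix (Fin n) (Fin n) ℝ,
      (∀ q ∈ R, W' q.1 q.2 = W q.1 q.2) → Exec k W' p s t s' := by
  induction h with
  | instr a s =>
    -- Only an in-range `getEntry` depends on the matrix; out of range it returns `0` whatever the
    -- matrix is.
    by_cases h : ∃ x i j, a = .getEntry x i j ∧ s.natReg i < n ∧ s.natReg j < n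
    · obtain ⟨x, i, j, rfl, hi, hj⟩ := h
      refine ⟨{(⟨_, hi⟩, ⟨_, hj⟩)}, by simp, fun W' hW' => ?_⟩
      have : (Instr.getEntry x i j).apply k W s = (Instr.getEntry x i j).apply k W' s := by
        simp only [Instr.apply, entry, hi, hj, and_self, dite_true]
        rw [hW' _ (Finset.mem_singleton_self _)]
      rw [this]
      exact .instr _ _
    · refine ⟨∅, by simp, fun W' _ => ?_⟩
      have : a.apply k W s = a.apply k W' s := by
        cases a with
        | getEntry x i j =>
          have : ¬ (s.natReg i < n ∧ s.natReg j < n) := fun hij => h ⟨x, i, j, rfl, hij⟩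
          simp [Instr.apply, entry, this]
        | _ => rfl
      rw [this]
      exact .instr _ _
  | seq _ _ ih ih' =>
    classical
    obtain ⟨R, hR, h⟩ := ih
    obtain ⟨R', hR', h'⟩ := ih'
    exact ⟨R ∪ R', (Finset.card_union_le _ _).trans (add_le_add hR hR'), fun W' hW' =>
      .seq (h _ fun q hq => hW' q (Finset.mem_union_left _ hq))
        (h' _ fun q hq => hW' q (Finset.mem_union_right _ hq))⟩
  | branch_true hb _ ih =>
    obtain ⟨R, hR, h⟩ := ih
    exact ⟨R, by omega, fun W' hW' => .branch_true hb (h _ hW')⟩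
  | branch_false hb _ ih =>
    obtain ⟨R, hR, h⟩ := ih
    exact ⟨R, by omega, fun W' hW' => .branch_false hb (h _ hW')⟩
  | loop_true hb _ _ ih ih' =>
    classical
    obtain ⟨R, hR, h⟩ := ih
    obtain ⟨R', hR', h'⟩ := ih'
    have := Finset.card_union_le R R'
    exact ⟨R ∪ R', by omega, fun W' hW' =>
      .loop_true hb (h _ fun q hq => hW' q (Finset.mem_union_left _ hq))
        (h' _ fun q hq => hW' q (Finset.mem_union_right _ hq))⟩
  | loop_false hb => exact ⟨∅, by simp, fun W' _ => .loop_false hb⟩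

/-! ### Principal eigenvectors in coordinates -/

theorem IsPrincipalEigenvector.sum_sq {n : ℕ} {W : Matrix (Fin n) (Fin n) ℝ}
    {u : EuclideanSpace ℝ (Fin n)} (hu : IsPrincipalEigenvector W u) : ∑ i, u i ^ 2 = 1 := by
  rw [← EuclideanSpace.real_norm_sq_eq, hu.1, one_pow]

/-- For a symmetric operator in finite dimension the supremum of the Rayleigh quotient is an
eigenvalue, so the largest eigenvalue bounds the whole quadratic form. Lower bounds for it can then
be read off from test vectors. -/
theorem IsPrincipalEigenvector.exists_eigenvalue {n : ℕ} {W : Matrix (Fin n) (Fin n) ℝ}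
    (hW : W.IsSymm) {u : EuclideanSpace ℝ (Fin n)} (hu : IsPrincipalEigenvector W u) :
    ∃ l : ℝ, (∀ i, ∑ j, W i j * u j = l * u i) ∧
      ∀ x : Fin n → ℝ, ∑ i, x i * ∑ j, W i j * x j ≤ l * ∑ i, x i ^ 2 := by
  obtain ⟨hu1, l, hl, hmax⟩ := hu
  refine ⟨l, fun i => ?_, fun x => ?_⟩
  · have := congrArg (fun y : EuclideanSpace ℝ (Fin n) => y i) hl.apply_eq_smul
    simpa [Matrix.toLpLin_apply, Matrix.mulVec, dotProduct] using this
  · set T := Matrix.toEuclideanLin W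
    have hT : T.IsSymmetric := Matrix.isSymmetric_toEuclideanLin_iff.2 (by
      rw [Matrix.IsHermitian, Matrix.conjTranspose_eq_transpose_of_trivial]
      exact hW)
    have : Nontrivial (EuclideanSpace ℝ (Fin n)) := ⟨u, 0, fun h => by simp [h] at hu1⟩
    have hsup := hmax _ hT.hasEigenvalue_iSup_of_finiteDimensional
    set y : EuclideanSpace ℝ (Fin n) := WithLp.toLp 2 x
    have hxy : ∑ i, x i * ∑ j, W i j * x j = inner ℝ (T y) y := by
      simp [T, y, PiLp.inner_apply, Matrix.mulVec, dotProduct]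
    have hy : ∑ i, x i ^ 2 = ‖y‖ ^ 2 := by
      rw [EuclideanSpace.real_norm_sq_eq]
    rw [hxy, hy]
    by_cases h0 : y = 0
    · simp [h0]
    rw [← div_le_iff₀ (by positivity)]
    refine le_trans ?_ hsup
    refine le_ciSup (f := fun x : { x : EuclideanSpace ℝ (Fin n) // x ≠ 0 } =>
      RCLike.re (inner ℝ (T x) x) / ‖(x : EuclideanSpace ℝ (Fin n))‖ ^ 2) ?_ ⟨y, h0⟩
    obtain ⟨B, hB⟩ := (LinearMap.toContinuousLinearMap T).bddAbove_rayleighQuotient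
    refine ⟨B, ?_⟩
    rintro _ ⟨z, rfl⟩
    exact (le_abs_self _).trans (hB ⟨z, rfl⟩)

/-! ### The lower bound for the computation of principal eigenvectors -/

/-- The vector `u` is constant, and the second matrix is `2 * 1_R - J` with `J` the all-ones matrix.
Pairing its eigenvalue equation with `u` gives `(b + n) * p = 2 * q`, where `p = ⟨u, v⟩` is close to
`1`, `b ≥ -1`, and `q`, a sum over `R`, satisfies `q ^ 2 ≤ |R|` by Cauchy-Schwarz. -/
theorem sq_le_of_isPrincipalEigenvector {n : ℕ} (R : Finset (Fin n × Fin n))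
    (hR : ∀ i j, (i, j) ∈ R ↔ (j, i) ∈ R) {u v : EuclideanSpace ℝ (Fin n)}
    (hu : IsPrincipalEigenvector (Matrix.of fun _ _ => 1) u)
    (hv : IsPrincipalEigenvector (Matrix.of fun i j => if (i, j) ∈ R then 1 else -1) v)
    (huv : ‖u - v‖ ≤ 1 / 50) : ((n : ℝ) - 1) ^ 2 ≤ 5 * R.card := by
  have hn : 0 < n := by
    rcases Nat.eq_zero_or_pos n with rfl | h
    · simpa using hu.sum_sq
    · exact h
  have hn' : (0 : ℝ) < n := by exact_mod_cast hn
  have hu1 := hu.sum_sq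
  have hv1 := hv.sum_sq
  obtain ⟨a, ha, ha'⟩ := hu.exists_eigenvalue (by ext; simp)
  obtain ⟨b, hb, hb'⟩ := hv.exists_eigenvalue (by ext i j; simp [hR i j])
  have han : (n : ℝ) ≤ a := by
    have := ha' fun _ => 1
    simp at this
    nlinarith
  obtain ⟨c, hc⟩ : ∃ c, ∀ i, u i = c := ⟨(∑ j, u j) / a, fun i => by
    have := ha i
    simp at this
    rw [this, mul_div_cancel_left₀ _ (hn'.trans_le han).ne']⟩
  have hc1 : n * c ^ 2 = 1 := by simpa [hc] using hu1
  have hbn : -1 ≤ b := by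
    have key (M : Matrix (Fin n) (Fin n) ℝ) (z : Fin n) :
        ∑ i, (Pi.single z 1 : Fin n → ℝ) i * ∑ j, M i j * (Pi.single z 1 : Fin n → ℝ) j =
          M z z := by
      simp [Pi.single_apply]
    -- The quadratic form at a standard basis vector is a diagonal entry, hence at least `-1`.
    have := hb' (Pi.single ⟨0, hn⟩ 1)
    rw [key] at this
    simp only [Matrix.of_apply, Pi.single_apply, ite_pow, one_pow, ne_eq, OfNat.ofNat_ne_zero,
      not_false_eq_true, zero_pow, Finset.sum_ite_eq', Finset.mem_univ, if_true, mul_one] at this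
    split_ifs at this <;> linarith
  set p := c * ∑ i, v i with hp
  have hp9 : 9 / 10 ≤ p := by
    have h : ‖u - v‖ ^ 2 ≤ (1 / 50) ^ 2 := by gcongr
    have h' : ‖u - v‖ ^ 2 = 2 - 2 * p := by
      rw [EuclideanSpace.real_norm_sq_eq]
      simp only [PiLp.sub_apply, hc, sub_sq, Finset.sum_add_distrib, Finset.sum_sub_distrib, hv1,
        hp, Finset.mul_sum]
      simp [hc1, mul_assoc]
      ring
    linarith
  set q := ∑ i, ∑ j, if (i, j) ∈ R then v i * c else 0 with hq
  have hpq : (b + n) * p = 2 * q := by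
    have h1 : ∑ j, c * ∑ i, (if (j, i) ∈ R then 1 else -1) * v i = b * p := by
      rw [hp, Finset.mul_sum, Finset.mul_sum]
      refine Finset.sum_congr rfl fun j _ => ?_
      have := hb j
      simp only [Matrix.of_apply] at this
      rw [this]
      ring
    have h2 : ∑ j, c * ∑ i, (if (j, i) ∈ R then 1 else -1) * v i =
        2 * q - n * p := by
      have h3 : (n : ℝ) * p = ∑ j : Fin n, ∑ i, c * v i := by
        simp [hp, Finset.mul_sum]
      rw [h3, hq, Finset.sum_comm (f := fun i j => if (i, j) ∈ R then v i * c else 0),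
        Finset.mul_sum, ← Finset.sum_sub_distrib]
      refine Finset.sum_congr rfl fun j _ => ?_
      rw [Finset.mul_sum, Finset.mul_sum, ← Finset.sum_sub_distrib]
      refine Finset.sum_congr rfl fun i _ => ?_
      simp only [hR j i]
      split_ifs <;> ring
    linarith
  have hqR : q ^ 2 ≤ R.card := by
    have h1 : q = ∑ x ∈ R, v x.1 * c := by
      rw [hq, ← Fintype.sum_prod_type' (f := fun i j => if (i, j) ∈ R then v i * c else 0)]
      simp
    have h2 : ∑ x ∈ R, (v x.1 * c) ^ 2 ≤ 1 := by
      refine (Finset.sum_le_univ_sum_of_nonneg fun x => sq_nonneg _).trans_eq ?_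
      rw [Fintype.sum_prod_type]
      simp only [mul_pow, Finset.sum_const, Finset.card_univ, Fintype.card_fin, nsmul_eq_mul]
      calc ∑ x, (n : ℝ) * (v x ^ 2 * c ^ 2) = (n * c ^ 2) * ∑ x, v x ^ 2 := by
            rw [Finset.mul_sum]
            exact Finset.sum_congr rfl fun _ _ => by ring
        _ = 1 := by rw [hc1, hv1, one_mul]
    have h3 := sq_sum_le_card_mul_sum_sq (s := R) (f := fun x => v x.1 * c)
    rw [h1]
    refine h3.trans ?_
    nlinarith [Nat.cast_nonneg (α := ℝ) R.card]
  have hn1 : (1 : ℝ) ≤ n := by exact_mod_cast hn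
  have h1 : ((n : ℝ) - 1) * (9 / 10) ≤ 2 * q := by
    rw [← hpq]
    exact mul_le_mul (by linarith) hp9 (by norm_num) (by linarith)
  have h2 : (((n : ℝ) - 1) * (9 / 10)) ^ 2 ≤ (2 * q) ^ 2 :=
    pow_le_pow_left₀ (mul_nonneg (by linarith) (by norm_num)) h1 2
  nlinarith

/-- Adversary argument: the run on the all-ones matrix is also the run on the matrix with `-1` at
the unread positions, so a single output must be accurate for both. -/
theorem sq_le_of_computesEigenvector {n k : ℕ} {p : Program} {T : ℕ}
    (hp : ∀ W : Matrix (Fin n) (Fin n) ℝ, IsSignMatrix W → ComputesEigenvector k W p)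
    (hT : RunsInTime n k p T) : n ^ 2 ≤ 40 * T := by
  classical
  have h0 : IsSignMatrix (Matrix.of fun _ _ => 1 : Matrix (Fin n) (Fin n) ℝ) :=
    ⟨by ext; simp, by simp⟩
  obtain ⟨t, s, he, v, hv, hsv⟩ := hp _ h0
  obtain ⟨t', s', he', ht'⟩ := hT _ h0
  obtain ⟨rfl, -⟩ := he.deterministic he'
  obtain ⟨R, hR, hRe⟩ := he.exists_queries
  -- The set of queries is closed under transposition so that the altered matrix is symmetric; this
  -- at most doubles it.
  set R' := R ∪ R.map (Equiv.prodComm _ _).toEmbedding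
  have hmem (i j : Fin n) : (i, j) ∈ R' ↔ (i, j) ∈ R ∨ (j, i) ∈ R := by
    simp [R']
  have hsymm (i j : Fin n) : (i, j) ∈ R' ↔ (j, i) ∈ R' := by
    rw [hmem, hmem, or_comm]
  have h1 : IsSignMatrix (Matrix.of fun i j => if (i, j) ∈ R' then 1 else -1 :
      Matrix (Fin n) (Fin n) ℝ) := by
    refine ⟨by ext i j; simp [hsymm i j], fun i j => ?_⟩
    simp only [Matrix.of_apply]
    split_ifs <;> simp
  obtain ⟨t₁, s₁, he₁, v₁, hv₁, hsv₁⟩ := hp _ h1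
  obtain ⟨-, rfl⟩ := he₁.deterministic (hRe _ fun q hq => by
    have : (q.1, q.2) ∈ R' := (hmem _ _).2 (.inl hq)
    simp [this])
  have hdist : ‖v - v₁‖ ≤ 1 / 50 := by
    have := norm_sub_le_norm_sub_add_norm_sub v (s₁.vec n) v₁
    rw [norm_sub_rev v (s₁.vec n)] at this
    linarith
  have key := sq_le_of_isPrincipalEigenvector R' hsymm hv hv₁ hdist
  have hcard : R'.card ≤ 2 * T := by
    have := Finset.card_union_le R (R.map (Equiv.prodComm _ _).toEmbedding)
    rw [Finset.card_map] at this
    exact this.trans (by omega)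
  have hcard' : (R'.card : ℝ) ≤ 2 * T := by exact_mod_cast hcard
  have hT1 : (1 : ℝ) ≤ T := by exact_mod_cast he.one_le.trans ht'
  -- From `(n - 1) ^ 2 ≤ 10 * T`, `n ^ 2 ≤ 2 * (n - 1) ^ 2 + 2` and `1 ≤ T`.
  have : (n : ℝ) ^ 2 ≤ 40 * T := by
    nlinarith [sq_nonneg ((n : ℝ) - 2)]
  exact_mod_cast this

/-! ### Recovery of the clique from an accurate vector -/

/-- The part of `W` outside of `S × S`. -/
noncomputable def offBlock {n : ℕ} (S : Finset (Fin n)) (W : Matrix (Fin n) (Fin n) ℝ) :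
    Matrix (Fin n) (Fin n) ℝ :=
  Matrix.of fun i j => if i ∈ S ∧ j ∈ S then 0 else W i j

/-- Each `i ∈ S \ B` and `j ∈ B \ S` satisfy `w i ≤ w j`, so `(b - w i) + w j ≥ b` and the two
squared errors add up to at least `b ^ 2 / 2`. The sets have equal size, so averaging over all pairs
gives the bound. -/
theorem IsTopSet.card_sdiff_mul_sq_le {n k : ℕ} {w : Fin n → ℝ} {B S : Finset (Fin n)}
    (hB : IsTopSet w k B) (hS : S.card = k) {b d : ℝ} (hb : 0 ≤ b)
    (h : ∑ i, (w i - if i ∈ S then b else 0) ^ 2 ≤ d) : (S \ B).card * b ^ 2 ≤ 2 * d := by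
  have hcard : (B \ S).card = (S \ B).card := Finset.card_sdiff_comm (hB.1.trans hS.symm)
  have hd : 0 ≤ d := (Finset.sum_nonneg fun i _ => sq_nonneg _).trans h
  rcases Nat.eq_zero_or_pos (S \ B).card with h0 | h0
  · rw [h0]
    simpa using hd
  have h1 : ∑ i ∈ S \ B, (w i - b) ^ 2 + ∑ i ∈ B \ S, w i ^ 2 ≤ d := by
    have e1 : ∑ i ∈ S \ B, (w i - b) ^ 2 =
        ∑ i ∈ S \ B, (w i - if i ∈ S then b else 0) ^ 2 :=
      Finset.sum_congr rfl fun i hi => by rw [if_pos (Finset.mem_sdiff.1 hi).1]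
    have e2 : ∑ i ∈ B \ S, w i ^ 2 = ∑ i ∈ B \ S, (w i - if i ∈ S then b else 0) ^ 2 :=
      Finset.sum_congr rfl fun i hi => by rw [if_neg (Finset.mem_sdiff.1 hi).2, sub_zero]
    rw [e1, e2, ← Finset.sum_union (by
      rw [Finset.disjoint_left]
      intro i hi hi'
      exact (Finset.mem_sdiff.1 hi').2 (Finset.mem_sdiff.1 hi).1)]
    exact (Finset.sum_le_univ_sum_of_nonneg fun i => sq_nonneg _).trans h
  have h2 : ∑ i ∈ S \ B, ∑ j ∈ B \ S, b ^ 2 / 2 ≤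
      ∑ i ∈ S \ B, ∑ j ∈ B \ S, ((w i - b) ^ 2 + w j ^ 2) := by
    refine Finset.sum_le_sum fun i hi => Finset.sum_le_sum fun j hj => ?_
    have hij : w i ≤ w j := hB.2 j (Finset.mem_sdiff.1 hj).1 i (Finset.mem_sdiff.1 hi).2
    nlinarith [sq_nonneg (w i - b + w j), mul_nonneg hb (sub_nonneg.2 hij),
      sq_nonneg (w j - w i)]
  simp only [Finset.sum_add_distrib, Finset.sum_const, nsmul_eq_mul, hcard,
    ← Finset.mul_sum] at h2
  have h0' : (0 : ℝ) < (S \ B).card := by exact_mod_cast h0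
  have h3 : ((S \ B).card : ℝ) * (b ^ 2 / 2) ≤ d := by
    refine le_trans (le_of_mul_le_mul_left ?_ h0') h1
    rw [mul_add]
    exact h2
  linarith

/-- The row sum over `S` is twice the number of ones minus `|S|`, which yields `(1 + 2/5) / 2 =
7/10`. The vertices of `B \ S` are all counted as neighbours. -/
theorem neighborCount_le {n : ℕ} {W : Matrix (Fin n) (Fin n) ℝ} (hW : IsSignMatrix W)
    {S : Finset (Fin n)} (B : Finset (Fin n)) {i : Fin n}
    (hi : ∑ j ∈ S, W i j ≤ 2 / 5 * S.card) :
    (neighborCount W B i : ℝ) ≤ 7 / 10 * S.card + (B \ S).card := by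
  classical
  have h1 : neighborCount W B i ≤ (S.filter fun j => W i j = 1).card + (B \ S).card := by
    refine le_trans (Finset.card_le_card fun j hj => ?_) (Finset.card_union_le _ _)
    simp only [Finset.mem_union, Finset.mem_filter, Finset.mem_sdiff] at hj ⊢
    tauto
  have h2 : ∑ j ∈ S, W i j = 2 * (S.filter fun j => W i j = 1).card - S.card := by
    have : ∀ j ∈ S, W i j = 2 * (if W i j = 1 then 1 else 0) - 1 := fun j _ => by
      rcases hW.2 i j with h | h <;> rw [h] <;> norm_num
    rw [Finset.sum_congr rfl this, Finset.sum_sub_distrib, ← Finset.mul_sum, Finset.sum_boole]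
    simp
  have h1' : (neighborCount W B i : ℝ) ≤ (S.filter fun j => W i j = 1).card + (B \ S).card := by
    exact_mod_cast h1
  linarith

theorem le_neighborCount {n : ℕ} {W : Matrix (Fin n) (Fin n) ℝ} {S B : Finset (Fin n)}
    (hS : ∀ i ∈ S, ∀ j ∈ S, W i j = 1) {i : Fin n} (hi : i ∈ S) :
    S.card ≤ neighborCount W B i + (S \ B).card + 1 := by
  classical
  have : S ⊆ ((B.filter fun j => j ≠ i ∧ W i j = 1) ∪ (S \ B)) ∪ {i} := fun j hj => by
    have := hS i hi j hj
    simp only [Finset.mem_union, Finset.mem_filter, Finset.mem_sdiff, Finset.mem_singleton]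
    tauto
  refine (Finset.card_le_card this).trans ((Finset.card_union_le _ _).trans ?_)
  rw [Finset.card_singleton]
  exact Nat.add_le_add_right (Finset.card_union_le _ _) 1

/-- The eigenvalue equation reads `l u - σ 1_S = Z u` with `σ = ∑ j ∈ S, u j`, and `l ≥ k` by
testing with `1_S`. Since `‖Z u‖ ≤ k/5`, this forces `σ ^ 2 ≥ 24/25 * k`, so `u` nearly aligns with
`1_S`. -/
theorem IsPrincipalEigenvector.exists_dist_indicator_le {n : ℕ} {W : Matrix (Fin n) (Fin n) ℝ}
    (hW : W.IsSymm) {S : Finset (Fin n)} (hcard : 0 < S.card)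
    (hS : ∀ i ∈ S, ∀ j ∈ S, W i j = 1)
    (hZ : ∀ x : Fin n → ℝ,
      ∑ i, (∑ j, offBlock S W i j * x j) ^ 2 ≤ (S.card / 5) ^ 2 * ∑ j, x j ^ 2)
    {u : EuclideanSpace ℝ (Fin n)} (hu : IsPrincipalEigenvector W u) :
    ∃ b : ℝ, S.card * b ^ 2 = 1 ∧ ‖u - WithLp.toLp 2 fun i => if i ∈ S then b else 0‖ ≤ 21 / 100 := by
  obtain ⟨l, hl, hmax⟩ := hu.exists_eigenvalue hW
  have hu1 := hu.sum_sq
  have hk : (0 : ℝ) < S.card := by exact_mod_cast hcard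
  set k : ℝ := (S.card : ℝ)
  set σ := ∑ j ∈ S, u j with hσ
  have hsplit (i : Fin n) (x : Fin n → ℝ) : ∑ j, W i j * x j =
      (if i ∈ S then ∑ j ∈ S, x j else 0) + ∑ j, offBlock S W i j * x j := by
    by_cases hi : i ∈ S
    · rw [if_pos hi, ← Finset.sum_filter_add_sum_filter_not Finset.univ (· ∈ S)]
      simp only [offBlock, Matrix.of_apply, hi, true_and, ite_mul, zero_mul]
      rw [Finset.filter_univ_mem, Finset.sum_congr rfl fun j hj => by rw [hS i hi j hj, one_mul],
        Finset.sum_filter]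
      simp only [ite_not]
    · simp [offBlock, hi]
  have hkl : k ≤ l := by
    have h := hmax fun i => if i ∈ S then 1 else 0
    have e : ∀ i ∈ S, ∑ j, W i j * (if j ∈ S then 1 else 0) = k := fun i hi => by
      simp only [mul_ite, mul_one, mul_zero]
      rw [← Finset.sum_filter, Finset.filter_univ_mem, Finset.sum_congr rfl (hS i hi)]
      simp [k]
    simp only [ite_mul, one_mul, zero_mul, ite_pow, one_pow, ne_eq, OfNat.ofNat_ne_zero,
      not_false_eq_true, zero_pow] at h
    rw [← Finset.sum_filter, Finset.filter_univ_mem, Finset.sum_congr rfl e,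
      ← Finset.sum_filter, Finset.filter_univ_mem] at h
    simp only [Finset.sum_const, nsmul_eq_mul, mul_one] at h
    exact le_of_mul_le_mul_right h hk
  have hexp (a c : ℝ) : ∑ i, (a * u i - if i ∈ S then c else 0) ^ 2 =
      a ^ 2 - 2 * a * c * σ + k * c ^ 2 := by
    have (i : Fin n) : (a * u i - if i ∈ S then c else 0) ^ 2 =
        a ^ 2 * u i ^ 2 - 2 * a * c * (if i ∈ S then u i else 0) + if i ∈ S then c ^ 2 else 0 := by
      split_ifs <;> ring
    simp only [this, Finset.sum_add_distrib, Finset.sum_sub_distrib, ← Finset.mul_sum, hu1]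
    simp [σ, k]
  have h1 : l ^ 2 - 2 * l * σ * σ + k * σ ^ 2 ≤ (k / 5) ^ 2 := by
    rw [← hexp]
    have := hZ fun i => u i
    rw [hu1, mul_one] at this
    refine le_trans (le_of_eq (Finset.sum_congr rfl fun i _ => ?_)) this
    rw [← hl, hsplit]
    simp [hσ]
  have h2 : 24 / 25 * k ≤ σ ^ 2 := by
    have hl0 : 0 < l := hk.trans_le hkl
    have h3 : l ^ 2 * (k - σ ^ 2) ≤ (k / 5) ^ 2 * k := by
      -- `k` times the left side of `h1` equals `(k σ - l σ) ^ 2 + l ^ 2 * (k - σ ^ 2)`.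
      nlinarith [sq_nonneg (k * σ - l * σ), mul_le_mul_of_nonneg_left h1 hk.le]
    by_contra! h4
    have : k ^ 2 * (k - σ ^ 2) ≤ l ^ 2 * (k - σ ^ 2) := by
      apply mul_le_mul_of_nonneg_right _ (by linarith)
      gcongr
    nlinarith [mul_pos hk hk]
  set r := √k with hr
  have hr0 : 0 < r := Real.sqrt_pos.2 hk
  have hr2 : r ^ 2 = k := Real.sq_sqrt hk.le
  have h3 : 979 / 1000 * r ≤ |σ| := by
    refine abs_le_of_sq_le_sq' ?_ (abs_nonneg _) |>.2
    rw [sq_abs, mul_pow, hr2]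
    linarith
  have hσ0 : σ ≠ 0 := abs_pos.1 (lt_of_lt_of_le (by positivity) h3)
  have hb : k * (σ / (|σ| * r)) ^ 2 = 1 := by
    rw [div_pow, mul_pow, sq_abs, hr2]
    field_simp
  -- The witness is `1/√k` with the sign of `σ`; the squared distance is `2 - 2|σ|/√k ≤ 0.042 ≤ 0.21
  -- ^ 2`.
  refine ⟨σ / (|σ| * r), hb, abs_le_of_sq_le_sq' ?_ (by norm_num) |>.2⟩
  rw [EuclideanSpace.real_norm_sq_eq]
  have := hexp 1 (σ / (|σ| * r))
  simp only [one_mul] at this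
  simp only [PiLp.sub_apply]
  have e2 : 2 * 1 * (σ / (|σ| * r)) * σ = 2 * (|σ| / r) := by
    rw [mul_one, mul_assoc, div_mul_eq_mul_div, ← sq, ← sq_abs]
    field_simp
  have e3 : 979 / 1000 ≤ |σ| / r := (le_div_iff₀ hr0).2 h3
  rw [this, hb, e2]
  linarith

/-- If `T ≠ S`, some `i ∈ T \ S` has at least as many neighbours in `B` as some `j ∈ S \ T`. But `i`
has at most `(7/10 + 1/10) k`, and `j` at least `9/10 * k - 1`, which is larger once `k ≥ 100`. -/
theorem IsSpectralEstimate.eq_clique {n : ℕ} {W : Matrix (Fin n) (Fin n) ℝ}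
    (hW : IsSignMatrix W) {S : Finset (Fin n)} (hcard : 100 ≤ S.card)
    (hS : ∀ i ∈ S, ∀ j ∈ S, W i j = 1)
    (hZ : ∀ x : Fin n → ℝ,
      ∑ i, (∑ j, offBlock S W i j * x j) ^ 2 ≤ (S.card / 5) ^ 2 * ∑ j, x j ^ 2)
    (hN : ∀ i ∉ S, ∑ j ∈ S, W i j ≤ 2 / 5 * S.card)
    {v : EuclideanSpace ℝ (Fin n)} (hv : IsApproxPrincipalEigenvector (1 / 100) W v)
    {T : Finset (Fin n)} (hT : IsSpectralEstimate W v S.card T) : T = S := by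
  obtain ⟨u, hu, huv⟩ := hv
  obtain ⟨B, hB, hTB⟩ := hT
  obtain ⟨b, hb, hub⟩ := hu.exists_dist_indicator_le hW.1 (by omega) hS hZ
  have hk : (100 : ℝ) ≤ S.card := by exact_mod_cast hcard
  have hvb : ‖v - WithLp.toLp 2 fun i => if i ∈ S then b else 0‖ ≤ 22 / 100 := by
    refine (norm_sub_le_norm_sub_add_norm_sub v u _).trans ?_
    linarith
  -- Absolute values do not increase the distance and remove the sign ambiguity of `b`.
  have hsum : ∑ i, (|v i| - if i ∈ S then |b| else 0) ^ 2 ≤ (22 / 100) ^ 2 := by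
    refine le_trans ?_ (pow_le_pow_left₀ (norm_nonneg _) hvb 2)
    rw [EuclideanSpace.real_norm_sq_eq]
    refine Finset.sum_le_sum fun i _ => ?_
    rw [sq_le_sq]
    simp only [PiLp.sub_apply]
    split_ifs
    · exact abs_abs_sub_abs_le_abs_sub _ _
    · simp
  have hm := hB.card_sdiff_mul_sq_le rfl (abs_nonneg b) hsum
  rw [sq_abs] at hm
  have hm' : ((S \ B).card : ℝ) ≤ 1 / 10 * S.card := by
    have h1 : 0 ≤ ((S \ B).card : ℝ) := Nat.cast_nonneg _
    calc ((S \ B).card : ℝ) = S.card * ((S \ B).card * b ^ 2) := by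
          rw [mul_left_comm, hb, mul_one]
      _ ≤ S.card * (2 * (22 / 100) ^ 2) := by gcongr
      _ ≤ 1 / 10 * S.card := by linarith
  have hBS : (B \ S).card = (S \ B).card := Finset.card_sdiff_comm hB.1
  refine Finset.eq_of_subset_of_card_le (fun i hi => ?_) hTB.1.ge
  by_contra hiS
  obtain ⟨j, hjS, hjT⟩ : ∃ j ∈ S, j ∉ T := by
    by_contra! h
    exact hiS ((Finset.eq_of_subset_of_card_le h hTB.1.le).symm ▸ hi)
  have h1 := hTB.2 i hi j hjT
  have h2 := neighborCount_le hW B (hN i hiS)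
  have h3 := le_neighborCount (B := B) hS hjS
  have h1' : (neighborCount W B j : ℝ) ≤ neighborCount W B i := by exact_mod_cast h1
  have h3' : (S.card : ℝ) ≤ neighborCount W B j + (S \ B).card + 1 := by exact_mod_cast h3
  rw [hBS] at h2
  linarith

/-! ### Concentration of linear forms in the entries -/

open ProbabilityTheory in
theorem hasSubgaussianMGF_signLaw : HasSubgaussianMGF id 1 signLaw := by
  have h := hasSubgaussianMGF_of_mem_Icc_of_integral_eq_zero (μ := signLaw) (X := id)
    (a := -1) (b := 1) measurable_id.aemeasurable ?_ ?_
  · convert h using 1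
    ext
    norm_num
  · simp [signLaw, ae_add_measure_iff, ae_dirac_eq]
  · rw [signLaw, integral_add_measure, integral_smul_measure, integral_smul_measure]
    · simp
    all_goals exact (integrable_dirac (by simp)).smul_measure (by simp)

open ProbabilityTheory in
theorem measure_pi_le_exp {ι : Type*} [Fintype ι] (μ : ι → Measure ℝ)
    [∀ i, IsProbabilityMeasure (μ i)] {c : ι → ℝ} (hc : ∀ i, c i = 0 ∨ μ i = signLaw) {t V : ℝ}
    (ht : 0 ≤ t) (hcV : ∑ i, c i ^ 2 ≤ V) :
    Measure.pi μ {z | t ≤ ∑ i, c i * z i} ≤ ENNReal.ofReal (Real.exp (-t ^ 2 / (2 * V))) := by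
  -- Vanishing coefficients are treated apart: the final comparison of exponents divides by `∑ i, c
  -- i ^ 2`.
  rcases (Finset.sum_nonneg fun i (_ : i ∈ Finset.univ) => sq_nonneg (c i)).eq_or_lt with h0 | h0
  · have hc0 (i : ι) : c i = 0 := by
      simpa using (Finset.sum_eq_zero_iff_of_nonneg fun i _ => sq_nonneg (c i)).1 h0.symm i
    simp only [hc0, zero_mul, Finset.sum_const_zero]
    rcases ht.eq_or_lt with rfl | ht
    · simp
    · simp [ht.not_ge]
  have hsub (i : ι) : HasSubgaussianMGF (fun z : ι → ℝ => c i * z i) (‖c i‖₊ ^ 2)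
      (Measure.pi μ) := by
    rcases hc i with h | h
    · simp only [h, zero_mul, nnnorm_zero, ne_eq, OfNat.ofNat_ne_zero, not_false_eq_true, zero_pow]
      exact HasSubgaussianMGF.fun_zero
    · have hid : HasSubgaussianMGF id 1 ((Measure.pi μ).map fun z => z i) := by
        rw [show (Measure.pi μ).map (fun z => z i) = μ i from (measurePreserving_eval μ i).map_eq, h]
        exact hasSubgaussianMGF_signLaw
      have hcongr (a : NNReal) (ha : (a : ℝ) = c i ^ 2)
          (h : HasSubgaussianMGF (fun z : ι → ℝ => c i * z i) a (Measure.pi μ)) :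
          HasSubgaussianMGF (fun z : ι → ℝ => c i * z i) (‖c i‖₊ ^ 2) (Measure.pi μ) := by
        rwa [show ‖c i‖₊ ^ 2 = a from NNReal.eq (by simp [ha])]
      exact hcongr _ (mul_one _) ((HasSubgaussianMGF.of_map (X := id) (Y := fun z : ι → ℝ => z i)
        (measurable_pi_apply i).aemeasurable hid).const_mul (c i))
  have hind : iIndepFun (fun i (z : ι → ℝ) => c i * z i) (Measure.pi μ) :=
    iIndepFun_pi (X := fun i x => c i * x) fun i => by fun_prop
  have key := HasSubgaussianMGF.measure_sum_ge_le_of_iIndepFun hind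
    (s := Finset.univ) (fun i _ => hsub i) ht
  rw [← ENNReal.ofReal_toReal (measure_ne_top (Measure.pi μ) _)]
  refine ENNReal.ofReal_le_ofReal (key.trans (Real.exp_le_exp.2 ?_))
  simp only [NNReal.coe_sum, NNReal.coe_pow, coe_nnnorm, Real.norm_eq_abs, sq_abs, neg_div]
  rw [neg_le_neg_iff]
  gcongr

theorem measurable_entry {n : ℕ} (i j : Fin n) :
    Measurable fun W : Matrix (Fin n) (Fin n) ℝ => W i j :=
  (measurable_pi_apply j).comp (measurable_pi_apply (X := fun _ => Fin n → ℝ) i)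

/-- The form is rewritten in the independent entries on and above the diagonal. Each collects at
most two coefficients, so the variance bound becomes `2 * V`, whence `4 * V` in the exponent. The
deterministic entries drop out because `a` vanishes on `S × S`. -/
theorem hiddenCliqueLaw_le_exp {n : ℕ} {S : Finset (Fin n)} {a : Fin n → Fin n → ℝ}
    (ha : ∀ i ∈ S, ∀ j ∈ S, a i j = 0) {t V : ℝ} (ht : 0 ≤ t)
    (haV : ∑ i, ∑ j, a i j ^ 2 ≤ V) :
    hiddenCliqueLaw S {W | t ≤ ∑ i, ∑ j, a i j * W i j} ≤
      ENNReal.ofReal (Real.exp (-t ^ 2 / (4 * V))) := by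
  classical
  let π : Fin n × Fin n → {p : Fin n × Fin n // p.1 ≤ p.2} :=
    fun q => ⟨(min q.1 q.2, max q.1 q.2), min_le_max⟩
  let c : {p : Fin n × Fin n // p.1 ≤ p.2} → ℝ := fun p =>
    ∑ q with π q = p, a q.1 q.2
  have hmeas : MeasurableSet {W : Matrix (Fin n) (Fin n) ℝ | t ≤ ∑ i, ∑ j, a i j * W i j} :=
    measurableSet_le measurable_const (Finset.measurable_sum _ fun i _ =>
      Finset.measurable_sum _ fun j _ => (measurable_entry i j).const_mul _)
  have hinst (p : {p : Fin n × Fin n // p.1 ≤ p.2}) : IsProbabilityMeasure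
      (if p.1.1 ∈ S ∧ p.1.2 ∈ S then Measure.dirac (1 : ℝ) else signLaw) := by
    split_ifs <;> infer_instance
  rw [hiddenCliqueLaw, hiddenSubmatrixLaw, Measure.map_apply measurable_symmetrize hmeas]
  have hmem (q : Fin n × Fin n) : q = (π q).1 ∨ q = (π q).1.swap := by
    rcases le_total q.1 q.2 with h | h
    · left
      simp [π, h]
    · right
      simp [π, h]
  have hset : symmetrize ⁻¹' {W : Matrix (Fin n) (Fin n) ℝ | t ≤ ∑ i, ∑ j, a i j * W i j} =
      {z | t ≤ ∑ p, c p * z p} := by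
    ext z
    simp only [Set.mem_preimage, Set.mem_ofPred_eq]
    rw [← Fintype.sum_prod_type' (f := fun i j => a i j * symmetrize z i j),
      ← Finset.sum_fiberwise Finset.univ π]
    refine iff_of_eq (congrArg _ (Finset.sum_congr rfl fun p _ => ?_))
    rw [Finset.sum_mul]
    refine Finset.sum_congr rfl fun q hq => ?_
    rw [← (Finset.mem_filter.1 hq).2]
    rfl
  have hc (p) : c p = 0 ∨
      (if p.1.1 ∈ S ∧ p.1.2 ∈ S then Measure.dirac (1 : ℝ) else signLaw) = signLaw := by
    by_cases h : p.1.1 ∈ S ∧ p.1.2 ∈ S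
    · left
      refine Finset.sum_eq_zero fun q hq => ?_
      have hq' := (Finset.mem_filter.1 hq).2
      rcases hmem q with h' | h' <;> rw [hq'] at h' <;> rw [h']
      · exact ha _ h.1 _ h.2
      · exact ha _ h.2 _ h.1
    · right
      rw [if_neg h]
  have hcV : ∑ p, c p ^ 2 ≤ 2 * V := by
    calc ∑ p, c p ^ 2 ≤ ∑ p, 2 * ∑ q with π q = p, a q.1 q.2 ^ 2 := by
          refine Finset.sum_le_sum fun p _ => sq_sum_le_card_mul_sum_sq.trans ?_
          refine mul_le_mul_of_nonneg_right ?_ (Finset.sum_nonneg fun _ _ => sq_nonneg _)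
          have : (Finset.univ.filter fun q => π q = p) ⊆ {p.1, p.1.swap} := fun q hq => by
            have hq' := (Finset.mem_filter.1 hq).2
            simpa [hq'] using hmem q
          exact_mod_cast (Finset.card_le_card this).trans Finset.card_le_two
      _ = 2 * ∑ i, ∑ j, a i j ^ 2 := by
          rw [← Finset.mul_sum, Finset.sum_fiberwise Finset.univ π (fun q => a q.1 q.2 ^ 2),
            Fintype.sum_prod_type]
      _ ≤ 2 * V := by gcongr
  rw [hset]
  have := measure_pi_le_exp _ hc ht hcV
  rwa [← mul_assoc, show (2 : ℝ) * 2 = 4 by norm_num] at this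

theorem ae_hiddenCliqueLaw {n : ℕ} (S : Finset (Fin n)) :
    ∀ᵐ W ∂hiddenCliqueLaw S, IsSignMatrix W ∧ ∀ i ∈ S, ∀ j ∈ S, W i j = 1 := by
  have hinst (p : {p : Fin n × Fin n // p.1 ≤ p.2}) : IsProbabilityMeasure
      (if p.1.1 ∈ S ∧ p.1.2 ∈ S then Measure.dirac (1 : ℝ) else signLaw) := by
    split_ifs <;> infer_instance
  have hev (p : {p : Fin n × Fin n // p.1 ≤ p.2}) (P : ℝ → Prop)
      (hP : ∀ᵐ x ∂(if p.1.1 ∈ S ∧ p.1.2 ∈ S then Measure.dirac (1 : ℝ) else signLaw), P x) :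
      ∀ᵐ z ∂(Measure.pi fun p : {p : Fin n × Fin n // p.1 ≤ p.2} =>
        if p.1.1 ∈ S ∧ p.1.2 ∈ S then Measure.dirac (1 : ℝ) else signLaw), P (z p) :=
    (Measure.quasiMeasurePreserving_eval (μ := fun p : {p : Fin n × Fin n // p.1 ≤ p.2} =>
        if p.1.1 ∈ S ∧ p.1.2 ∈ S then Measure.dirac (1 : ℝ) else signLaw) p).ae hP
  have h1 : ∀ᵐ W ∂hiddenCliqueLaw S, ∀ i j, W j i = W i j := by
    refine ae_all_iff.2 fun i => ae_all_iff.2 fun j => ?_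
    rw [hiddenCliqueLaw, hiddenSubmatrixLaw, ae_map_iff measurable_symmetrize.aemeasurable
      (measurableSet_eq_fun (measurable_entry j i) (measurable_entry i j))]
    exact .of_forall fun z => by simp [symmetrize, min_comm, max_comm]
  have h2 : ∀ᵐ W ∂hiddenCliqueLaw S, ∀ i j, W i j = 1 ∨ W i j = -1 := by
    refine ae_all_iff.2 fun i => ae_all_iff.2 fun j => ?_
    refine (ae_map_iff measurable_symmetrize.aemeasurable
      ((measurable_entry i j (measurableSet_singleton 1)).union
        (measurable_entry i j (measurableSet_singleton (-1))))).2 ?_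
    refine hev ⟨(min i j, max i j), min_le_max⟩ (fun x => x = 1 ∨ x = -1) ?_
    split_ifs
    · simp [ae_dirac_eq]
    · simp [signLaw, ae_add_measure_iff, ae_dirac_eq]
  have h3 : ∀ᵐ W ∂hiddenCliqueLaw S, ∀ i j, i ∈ S → j ∈ S → W i j = 1 := by
    refine ae_all_iff.2 fun i => ae_all_iff.2 fun j => ?_
    by_cases hij : i ∈ S ∧ j ∈ S
    swap
    · exact .of_forall fun W hi hj => absurd ⟨hi, hj⟩ hij
    suffices h : ∀ᵐ W ∂hiddenCliqueLaw S, W i j = 1 from h.mono fun W hW _ _ => hW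
    refine (ae_map_iff measurable_symmetrize.aemeasurable
      (measurable_entry i j (measurableSet_singleton 1))).2 ?_
    refine hev ⟨(min i j, max i j), min_le_max⟩ (fun x => x = 1) ?_
    have : min i j ∈ S ∧ max i j ∈ S := by
      rcases le_total i j with h | h <;> simp [h, hij]
    rw [if_pos this]
    simp [ae_dirac_eq]
  filter_upwards [h1, h2, h3] with W h1 h2 h3
  exact ⟨⟨by ext i j; exact h1 i j, h2⟩, fun i hi j hj => h3 i j hi hj⟩

/-! ### A net in the unit ball -/

/-- Integer points which, divided by `4 * √n`, form a net in the unit ball. -/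
noncomputable def ballNet (n : ℕ) : Finset (Fin n → ℤ) :=
  (Fintype.piFinset fun _ => Finset.Icc (-(4 * n : ℤ)) (4 * n)).filter fun y =>
    ∑ i, |y i| ≤ 4 * n ∧ ∑ i, y i ^ 2 ≤ 16 * n

theorem sum_Icc_two_inv_pow_natAbs_le (L : ℕ) :
    ∑ j ∈ Finset.Icc (-(L : ℤ)) L, (2⁻¹ : ℝ) ^ j.natAbs ≤ 3 := by
  suffices h : ∑ j ∈ Finset.Icc (-(L : ℤ)) L, (2⁻¹ : ℝ) ^ j.natAbs = 3 - 2 * 2⁻¹ ^ L by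
    rw [h]
    linarith [pow_pos (show (0 : ℝ) < 2⁻¹ by norm_num) L]
  induction L with
  | zero => norm_num
  | succ L ih =>
    have : Finset.Icc (-((L + 1 : ℕ) : ℤ)) (L + 1 : ℕ) =
        insert (-((L + 1 : ℕ) : ℤ)) (insert ((L + 1 : ℕ) : ℤ) (Finset.Icc (-(L : ℤ)) L)) := by
      ext x
      simp only [Finset.mem_insert, Finset.mem_Icc]
      omega
    rw [this, Finset.sum_insert (by simp; omega), Finset.sum_insert (by simp), ih, Int.natAbs_neg,
      Int.natAbs_natCast]
    ring

/-- Weight `y` by `2 ^ (-∑ |y i|)`. On the net this is at least `16 ^ (-n)`, while the weights over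
the whole box sum to at most `3 ^ n`, since they factor over the coordinates. -/
theorem card_ballNet_le (n : ℕ) : ((ballNet n).card : ℝ) ≤ 48 ^ n := by
  have h1 : ∀ y ∈ ballNet n, (1 : ℝ) ≤ 16 ^ n * ∏ i, 2⁻¹ ^ (y i).natAbs := fun y hy => by
    have hy' : ∑ i, (y i).natAbs ≤ 4 * n := by
      have := (Finset.mem_filter.1 hy).2.1
      zify
      exact this
    rw [Finset.prod_pow_eq_pow_sum, inv_pow, ← div_eq_mul_inv, one_le_div (by positivity)]
    calc (2 : ℝ) ^ ∑ i, (y i).natAbs ≤ 2 ^ (4 * n) := by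
          gcongr
          norm_num
      _ = 16 ^ n := by
          rw [pow_mul]
          norm_num
  calc ((ballNet n).card : ℝ) = ∑ y ∈ ballNet n, 1 := by simp
    _ ≤ ∑ y ∈ ballNet n, 16 ^ n * ∏ i, 2⁻¹ ^ (y i).natAbs := Finset.sum_le_sum h1
    _ ≤ ∑ y ∈ Fintype.piFinset fun _ : Fin n => Finset.Icc (-(4 * n : ℤ)) (4 * n),
          16 ^ n * ∏ i, 2⁻¹ ^ (y i).natAbs :=
        Finset.sum_le_sum_of_subset_of_nonneg (Finset.filter_subset _ _) fun _ _ _ => by positivity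
    _ = 16 ^ n * (∑ j ∈ Finset.Icc (-(4 * n : ℤ)) (4 * n), 2⁻¹ ^ j.natAbs) ^ n := by
        rw [← Finset.mul_sum, ← Finset.prod_univ_sum (fun _ : Fin n => Finset.Icc (-(4 * n : ℤ)) (4 * n))
          (fun _ j => (2⁻¹ : ℝ) ^ j.natAbs)]
        simp
    _ ≤ 16 ^ n * 3 ^ n := by
        gcongr
        exact_mod_cast sum_Icc_two_inv_pow_natAbs_le (4 * n)
    _ = 48 ^ n := by
        rw [← mul_pow]
        norm_num

/-- Rounding towards zero keeps the rounded vector inside the ball. -/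
theorem exists_int_abs_le (t : ℝ) : ∃ m : ℤ, |(m : ℝ)| ≤ |t| ∧ |t - m| ≤ 1 := by
  rcases le_total 0 t with h | h
  · refine ⟨⌊t⌋, ?_, ?_⟩
    · rw [abs_of_nonneg h, abs_of_nonneg (by exact_mod_cast Int.floor_nonneg.2 h)]
      exact Int.floor_le t
    · rw [abs_le]
      constructor <;> linarith [Int.floor_le t, Int.lt_floor_add_one t]
  · refine ⟨⌈t⌉, ?_, ?_⟩
    · have : (⌈t⌉ : ℝ) ≤ 0 := by exact_mod_cast Int.ceil_le.2 (by simpa using h)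
      rw [abs_of_nonpos h, abs_of_nonpos this]
      linarith [Int.le_ceil t]
    · rw [abs_le]
      constructor <;> linarith [Int.le_ceil t, Int.ceil_lt_add_one t]

/-- The point of the unit ball that belongs to a point of `ballNet n`. -/
noncomputable def ballNetPoint {n : ℕ} (y : Fin n → ℤ) : EuclideanSpace ℝ (Fin n) :=
  WithLp.toLp 2 fun i => y i / (4 * √n)

theorem norm_ballNetPoint_le {n : ℕ} {y : Fin n → ℤ} (hy : y ∈ ballNet n) :
    ‖ballNetPoint y‖ ≤ 1 := by
  refine abs_le_of_sq_le_sq' ?_ (by norm_num) |>.2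
  rw [EuclideanSpace.real_norm_sq_eq]
  have h : ((∑ i, y i ^ 2 : ℤ) : ℝ) ≤ ((16 * n : ℤ) : ℝ) :=
    Int.cast_le.2 (Finset.mem_filter.1 hy).2.2
  push_cast at h
  simp only [ballNetPoint, div_pow, mul_pow, Real.sq_sqrt (Nat.cast_nonneg n), one_pow]
  rw [← Finset.sum_div]
  exact div_le_one_of_le₀ (by linarith) (by positivity)

/-- Round `4√n x` coordinatewise towards zero: `n` errors of at most `1/(4√n)` have norm at most
`1/4`. The bound on `∑ |y i|` is Cauchy-Schwarz. -/
theorem exists_ballNet {n : ℕ} (hn : 0 < n) {x : EuclideanSpace ℝ (Fin n)} (hx : ‖x‖ ≤ 1) :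
    ∃ y ∈ ballNet n, ‖x - ballNetPoint y‖ ≤ 1 / 4 := by
  have hn' : (0 : ℝ) < n := by exact_mod_cast hn
  have hr : 0 < √(n : ℝ) := Real.sqrt_pos.2 hn'
  have hx2 : ∑ i, x i ^ 2 ≤ 1 := by
    rw [← EuclideanSpace.real_norm_sq_eq]
    exact pow_le_one₀ (norm_nonneg _) hx
  choose y hy1 hy2 using fun i => exists_int_abs_le (4 * √n * x i)
  have hsq : ∑ i, y i ^ 2 ≤ 16 * n := by
    have : ∑ i, (y i : ℝ) ^ 2 ≤ 16 * n := by
      calc ∑ i, (y i : ℝ) ^ 2 ≤ ∑ i, (4 * √n * x i) ^ 2 :=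
            Finset.sum_le_sum fun i _ => sq_le_sq.2 (hy1 i)
        _ = 16 * n * ∑ i, x i ^ 2 := by
            rw [Finset.mul_sum]
            refine Finset.sum_congr rfl fun i _ => ?_
            rw [mul_pow, mul_pow, Real.sq_sqrt hn'.le]
            norm_num
        _ ≤ 16 * n := mul_le_of_le_one_right (by positivity) hx2
    exact_mod_cast this
  have habs : ∑ i, |y i| ≤ 4 * n := by
    have h := sq_sum_le_card_mul_sum_sq (s := Finset.univ) (f := fun i => |y i|)
    simp only [sq_abs, Finset.card_univ, Fintype.card_fin] at h
    have h0 : (0 : ℤ) ≤ n := by positivity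
    refine abs_le_of_sq_le_sq' ?_ (by positivity) |>.2
    nlinarith
  refine ⟨y, Finset.mem_filter.2 ⟨?_, habs, hsq⟩, ?_⟩
  · refine Fintype.mem_piFinset.2 fun i => Finset.mem_Icc.2 (abs_le.1 ?_)
    exact (Finset.single_le_sum (f := fun i => |y i|) (fun _ _ => abs_nonneg _)
      (Finset.mem_univ i)).trans habs
  · refine abs_le_of_sq_le_sq' ?_ (by norm_num) |>.2
    rw [EuclideanSpace.real_norm_sq_eq]
    calc ∑ i, (x - ballNetPoint y) i ^ 2 ≤ ∑ _i : Fin n, 1 / (16 * n : ℝ) := by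
          refine Finset.sum_le_sum fun i _ => ?_
          have e : (x - ballNetPoint y) i = (4 * √n * x i - y i) / (4 * √n) := by
            simp only [ballNetPoint, PiLp.sub_apply]
            field_simp
          rw [e, div_pow, mul_pow, Real.sq_sqrt hn'.le, show (4 : ℝ) ^ 2 = 16 by norm_num]
          gcongr
          exact (sq_le_one_iff_abs_le_one _).2 (hy2 i)
      _ = (1 / 4) ^ 2 := by
          simp
          field_simp
          norm_num

/-- A bilinear form that is at most `t` on a net has norm at most `2 * t`. -/
theorem sum_sq_le_of_ballNet {n : ℕ} (hn : 0 < n) {A : Matrix (Fin n) (Fin n) ℝ} {t : ℝ}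
    (ht : 0 ≤ t) (h : ∀ y ∈ ballNet n, ∀ z ∈ ballNet n,
      ∑ i, ∑ j, ballNetPoint y i * ballNetPoint z j * A i j ≤ t) (x : Fin n → ℝ) :
    ∑ i, (∑ j, A i j * x j) ^ 2 ≤ (2 * t) ^ 2 * ∑ j, x j ^ 2 := by
  set T := LinearMap.toContinuousLinearMap (Matrix.toEuclideanLin A)
  have hT (x : EuclideanSpace ℝ (Fin n)) (i : Fin n) : T x i = ∑ j, A i j * x j := by
    simp [T, Matrix.toLpLin_apply, Matrix.mulVec, dotProduct]
  have hunit (x w : EuclideanSpace ℝ (Fin n)) (hx : ‖x‖ ≤ 1) (hw : ‖w‖ ≤ 1) :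
      inner ℝ w (T x) ≤ t + ‖T‖ / 2 := by
    obtain ⟨z, hz, hxz⟩ := exists_ballNet hn hx
    obtain ⟨y, hy, hwy⟩ := exists_ballNet hn hw
    -- Each replacement by a net point costs `‖T‖ / 4`; the resulting `‖T‖ ≤ t + ‖T‖ / 2` is then
    -- solved for `‖T‖`.
    have e : inner ℝ w (T x) = inner ℝ (ballNetPoint y) (T (ballNetPoint z)) +
        inner ℝ w (T (x - ballNetPoint z)) +
        inner ℝ (w - ballNetPoint y) (T (ballNetPoint z)) := by
      simp only [map_sub, inner_sub_left, inner_sub_right]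
      ring
    have h1 : inner ℝ (ballNetPoint y) (T (ballNetPoint z)) ≤ t := by
      refine le_trans (le_of_eq ?_) (h y hy z hz)
      simp only [PiLp.inner_apply, hT, RCLike.inner_apply, conj_trivial, Finset.sum_mul]
      exact Finset.sum_congr rfl fun i _ => Finset.sum_congr rfl fun j _ => by ring
    have h2 : inner ℝ w (T (x - ballNetPoint z)) ≤ 1 * (‖T‖ * (1 / 4)) :=
      (real_inner_le_norm _ _).trans (mul_le_mul hw ((T.le_opNorm _).trans (by gcongr))
        (norm_nonneg _) zero_le_one)
    have h3 : inner ℝ (w - ballNetPoint y) (T (ballNetPoint z)) ≤ 1 / 4 * (‖T‖ * 1) :=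
      (real_inner_le_norm _ _).trans (mul_le_mul hwy ((T.le_opNorm _).trans
        (by gcongr; exact norm_ballNetPoint_le hz)) (norm_nonneg _) (by norm_num))
    linarith
  have hnorm : ‖T‖ ≤ 2 * t := by
    have : ‖T‖ ≤ t + ‖T‖ / 2 := by
      refine ContinuousLinearMap.opNorm_le_of_unit_norm (by positivity) fun x hx => ?_
      by_cases h0 : T x = 0
      · rw [h0, norm_zero]
        positivity
      have := hunit x (‖T x‖⁻¹ • T x) hx.le (by
        rw [norm_smul, norm_inv, norm_norm, inv_mul_cancel₀ (norm_ne_zero_iff.2 h0)])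
      rwa [real_inner_smul_left, real_inner_self_eq_norm_sq, sq, inv_mul_cancel_left₀
        (norm_ne_zero_iff.2 h0)] at this
    linarith
  have h1 := T.le_of_opNorm_le hnorm (WithLp.toLp 2 x)
  have h2 := pow_le_pow_left₀ (norm_nonneg _) h1 2
  rw [mul_pow, EuclideanSpace.real_norm_sq_eq, EuclideanSpace.real_norm_sq_eq] at h2
  simpa only [hT] using h2

/-! ### The probability of failure -/

/-- The coefficients have square sum at most `1`, so each pair of net points fails with probability
at most `exp (-25 n)`. There are at most `48 ^ (2 n)` pairs, and `48 ^ 2 * 2 ^ (-25) ≤ 1/2`. -/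
theorem hiddenCliqueLaw_bilinear_le {n : ℕ} (S : Finset (Fin n)) :
    hiddenCliqueLaw S {W | ∃ y ∈ ballNet n, ∃ z ∈ ballNet n,
      10 * √n ≤ ∑ i, ∑ j, ballNetPoint y i * ballNetPoint z j * offBlock S W i j} ≤
      ENNReal.ofReal ((1 / 2) ^ n) := by
  have hsub : {W : Matrix (Fin n) (Fin n) ℝ | ∃ y ∈ ballNet n, ∃ z ∈ ballNet n,
      10 * √n ≤ ∑ i, ∑ j, ballNetPoint y i * ballNetPoint z j * offBlock S W i j} ⊆
      ⋃ q ∈ ballNet n ×ˢ ballNet n, {W | 10 * √n ≤ ∑ i, ∑ j,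
        (if i ∈ S ∧ j ∈ S then 0 else ballNetPoint q.1 i * ballNetPoint q.2 j) * W i j} := by
    rintro W ⟨y, hy, z, hz, h⟩
    refine Set.mem_biUnion (x := (y, z)) (Finset.mk_mem_product hy hz) (h.trans_eq ?_)
    refine Finset.sum_congr rfl fun i _ => Finset.sum_congr rfl fun j _ => ?_
    simp only [offBlock, Matrix.of_apply]
    split_ifs <;> simp
  have hq : ∀ q ∈ ballNet n ×ˢ ballNet n, hiddenCliqueLaw S {W | 10 * √n ≤ ∑ i, ∑ j,
      (if i ∈ S ∧ j ∈ S then 0 else ballNetPoint q.1 i * ballNetPoint q.2 j) * W i j} ≤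
      ENNReal.ofReal (Real.exp (-25) ^ n) := fun q hq => by
    obtain ⟨h1, h2⟩ := Finset.mem_product.1 hq
    refine (hiddenCliqueLaw_le_exp (V := 1) (fun i hi j hj => by simp [hi, hj]) (by positivity)
      ?_).trans_eq ?_
    · calc ∑ i, ∑ j, (if i ∈ S ∧ j ∈ S then 0 else ballNetPoint q.1 i * ballNetPoint q.2 j) ^ 2
          ≤ ∑ i, ∑ j, ballNetPoint q.1 i ^ 2 * ballNetPoint q.2 j ^ 2 := by
            refine Finset.sum_le_sum fun i _ => Finset.sum_le_sum fun j _ => ?_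
            split_ifs
            · rw [zero_pow two_ne_zero]
              positivity
            · rw [mul_pow]
        _ = ‖ballNetPoint q.1‖ ^ 2 * ‖ballNetPoint q.2‖ ^ 2 := by
            rw [EuclideanSpace.real_norm_sq_eq, EuclideanSpace.real_norm_sq_eq,
              Finset.sum_mul_sum]
        _ ≤ 1 := mul_le_one₀ (pow_le_one₀ (norm_nonneg _) (norm_ballNetPoint_le h1)) (by positivity)
            (pow_le_one₀ (norm_nonneg _) (norm_ballNetPoint_le h2))
    · rw [mul_pow, Real.sq_sqrt (Nat.cast_nonneg n), ← Real.exp_nat_mul]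
      congr 2
      ring
  refine (measure_mono hsub).trans ((measure_biUnion_finset_le _ _).trans
    ((Finset.sum_le_sum hq).trans ?_))
  rw [Finset.sum_const, nsmul_eq_mul, ← ENNReal.ofReal_natCast,
    ← ENNReal.ofReal_mul (Nat.cast_nonneg _)]
  refine ENNReal.ofReal_le_ofReal ?_
  have hexp : Real.exp (-25) ≤ 1 / 2 ^ 25 := by
    have h := pow_le_pow_left₀ zero_le_two Real.exp_one_gt_two.le 25
    rw [← Real.exp_nat_mul] at h
    rw [Real.exp_neg, ← one_div]
    refine one_div_le_one_div_of_le (by positivity) (h.trans_eq ?_)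
    norm_num
  rw [Finset.card_product]
  push_cast
  calc ((ballNet n).card : ℝ) * (ballNet n).card * Real.exp (-25) ^ n
      ≤ 48 ^ n * 48 ^ n * (1 / 2 ^ 25) ^ n := by
        gcongr <;> exact card_ballNet_le n
    _ = (48 * 48 * (1 / 2 ^ 25)) ^ n := by rw [mul_pow, mul_pow]
    _ ≤ (1 / 2) ^ n := by
        gcongr
        norm_num

/-- For one vertex the tail bound with `t = 2k/5` and `V = k` is `exp (-k/25)`, at most `exp
(-4√n)`. -/
theorem hiddenCliqueLaw_neighbors_le {n : ℕ} {S : Finset (Fin n)}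
    (hS : 100 * √n < S.card) :
    hiddenCliqueLaw S {W | ∃ i ∉ S, 2 / 5 * S.card ≤ ∑ j ∈ S, W i j} ≤
      ENNReal.ofReal (n * Real.exp (-(4 * √n))) := by
  have hk : (0 : ℝ) < S.card := lt_of_le_of_lt (by positivity) hS
  have hsub : {W : Matrix (Fin n) (Fin n) ℝ | ∃ i ∉ S, 2 / 5 * S.card ≤ ∑ j ∈ S, W i j} ⊆
      ⋃ i ∈ Finset.univ \ S, {W | 2 / 5 * (S.card : ℝ) ≤
        ∑ l, ∑ j, (if l = i ∧ j ∈ S then 1 else 0) * W l j} := by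
    rintro W ⟨i, hi, h⟩
    have e : ∑ l, ∑ j, (if l = i ∧ j ∈ S then 1 else 0) * W l j = ∑ j ∈ S, W i j := by
      rw [Finset.sum_eq_single i (fun l _ hl => by simp [hl]) (by simp)]
      simp
    exact Set.mem_biUnion (x := i) (by simpa using hi) (h.trans_eq e.symm)
  have hi : ∀ i ∈ Finset.univ \ S, hiddenCliqueLaw S {W | 2 / 5 * (S.card : ℝ) ≤
      ∑ l, ∑ j, (if l = i ∧ j ∈ S then 1 else 0) * W l j} ≤
      ENNReal.ofReal (Real.exp (-(4 * √n))) := fun i hi => by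
    refine (hiddenCliqueLaw_le_exp (V := S.card) (fun l hl j hj => ?_) (by positivity) ?_).trans
      (ENNReal.ofReal_le_ofReal (Real.exp_le_exp.2 ?_))
    · rw [if_neg]
      rintro ⟨rfl, -⟩
      exact (Finset.mem_sdiff.1 hi).2 hl
    · rw [Finset.sum_eq_single i (fun l _ hl => by simp [hl]) (by simp)]
      simp
    · rw [neg_div, neg_le_neg_iff, le_div_iff₀ (by positivity)]
      nlinarith
  refine (measure_mono hsub).trans ((measure_biUnion_finset_le _ _).trans
    ((Finset.sum_le_sum hi).trans ?_))
  rw [Finset.sum_const, nsmul_eq_mul, ← ENNReal.ofReal_natCast,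
    ← ENNReal.ofReal_mul (Nat.cast_nonneg _)]
  refine ENNReal.ofReal_le_ofReal (mul_le_mul_of_nonneg_right ?_ (Real.exp_nonneg _))
  exact_mod_cast (Finset.card_le_univ _).trans_eq (Fintype.card_fin n)

/-- An accurate vector and a spectral estimate built from it that differs from `S` exist with
probability at most `2 / n`. -/
theorem hiddenCliqueLaw_failure_le {n : ℕ} (hn : 0 < n) {S : Finset (Fin n)}
    (hS : 100 * √n < S.card) :
    hiddenCliqueLaw S {W | ∃ (v : EuclideanSpace ℝ (Fin n)) (T : Finset (Fin n)),
      IsApproxPrincipalEigenvector (1 / 100) W v ∧ IsSpectralEstimate W v S.card T ∧ T ≠ S} ≤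
      ENNReal.ofReal (2 / n) := by
  have hn1 : (1 : ℝ) ≤ n := by exact_mod_cast hn
  have hr : 1 ≤ √(n : ℝ) := Real.one_le_sqrt.2 hn1
  have hcard : 100 ≤ S.card := by
    have : (100 : ℝ) ≤ S.card := by linarith
    exact_mod_cast this
  have hsub : {W : Matrix (Fin n) (Fin n) ℝ | ∃ (v : EuclideanSpace ℝ (Fin n))
      (T : Finset (Fin n)), IsApproxPrincipalEigenvector (1 / 100) W v ∧
        IsSpectralEstimate W v S.card T ∧ T ≠ S} ⊆
      {W | ¬ (IsSignMatrix W ∧ ∀ i ∈ S, ∀ j ∈ S, W i j = 1)} ∪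
      ({W | ∃ y ∈ ballNet n, ∃ z ∈ ballNet n,
        10 * √n ≤ ∑ i, ∑ j, ballNetPoint y i * ballNetPoint z j * offBlock S W i j} ∪
      {W | ∃ i ∉ S, 2 / 5 * S.card ≤ ∑ j ∈ S, W i j}) := by
    rintro W ⟨v, T, hv, hT, hne⟩
    by_contra h
    obtain ⟨h1, h'⟩ := not_or.1 h
    obtain ⟨h2, h3⟩ := not_or.1 h'
    obtain ⟨hW, hWS⟩ := not_not.1 h1
    refine hne (hT.eq_clique hW hcard hWS (fun x => ?_)
      (fun i hi => (not_le.1 fun hle => h3 ⟨i, hi, hle⟩).le) hv)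
    refine (sum_sq_le_of_ballNet hn (t := 10 * √n) (by positivity)
      (fun y hy z hz => (not_le.1 fun hle => h2 ⟨y, hy, z, hz, hle⟩).le) x).trans
      (mul_le_mul_of_nonneg_right ?_ (Finset.sum_nonneg fun _ _ => sq_nonneg _))
    -- This is where the constant `100` enters: `2 * 10√n ≤ k / 5`.
    refine pow_le_pow_left₀ (by positivity) ?_ 2
    linarith
  refine (measure_mono hsub).trans ((measure_union_le _ _).trans ?_)
  rw [show hiddenCliqueLaw S {W | ¬ (IsSignMatrix W ∧ ∀ i ∈ S, ∀ j ∈ S, W i j = 1)} = 0 from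
    ae_iff.1 (ae_hiddenCliqueLaw S), zero_add]
  refine (measure_union_le _ _).trans ((add_le_add (hiddenCliqueLaw_bilinear_le S)
    (hiddenCliqueLaw_neighbors_le hS)).trans ?_)
  rw [← ENNReal.ofReal_add (by positivity) (by positivity)]
  refine ENNReal.ofReal_le_ofReal ?_
  have h1 : (1 / 2 : ℝ) ^ n ≤ 1 / n := by
    rw [one_div_pow]
    refine one_div_le_one_div_of_le (by positivity) ?_
    exact_mod_cast Nat.lt_two_pow_self.le
  have h2 : n * Real.exp (-(4 * √n)) ≤ 1 / n := by
    -- The fourth-order term suffices: `(4√n) ^ 4 / 4! = 256 n ^ 2 / 24 ≥ n ^ 2`.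
    have h := Real.pow_div_factorial_le_exp (4 * √n) (by positivity) 4
    have e : (√(n : ℝ)) ^ 4 = n ^ 2 := by
      rw [show 4 = 2 * 2 from rfl, pow_mul, Real.sq_sqrt (Nat.cast_nonneg n)]
    rw [mul_pow, e] at h
    norm_num [Nat.factorial] at h
    rw [Real.exp_neg, ← div_eq_mul_inv, div_le_div_iff₀ (Real.exp_pos _) (by positivity)]
    nlinarith
  calc (1 / 2 : ℝ) ^ n + n * Real.exp (-(4 * √n)) ≤ 1 / n + 1 / n := add_le_add h1 h2
    _ = 2 / n := by ring

theorem exists_forall_ofReal_two_div_le {ε : ENNReal} (hε : 0 < ε) :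
    ∃ N : ℕ, ∀ n ≥ N, ENNReal.ofReal (2 / n) ≤ ε := by
  have h : Filter.Tendsto (fun n : ℕ => ENNReal.ofReal (2 / n)) Filter.atTop (nhds 0) := by
    rw [← ENNReal.ofReal_zero]
    exact ENNReal.tendsto_ofReal (tendsto_const_div_atTop_nhds_zero_nat 2)
  exact Filter.eventually_atTop.1 (h.eventually_le_const hε)

end HiddenClique

/-! ### The main theorem -/

theorem mainTheorem4 :
    ∃ (cleanup : HiddenClique.Program) (C : ℕ),
      -- started with any vector `v` in the output cells of the eigenvector computation,
      -- `cleanup` takes `O(n ^ 2)` steps and returns a spectral estimate built from `v`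
      (∀ n k : ℕ, 1 ≤ n → k ≤ n →
        ∀ W : Matrix (Fin n) (Fin n) ℝ, HiddenClique.IsSignMatrix W →
        ∀ s : HiddenClique.State, ∃ (t : ℕ) (s' : HiddenClique.State),
          HiddenClique.Exec k W cleanup s t s' ∧ t ≤ C * n ^ 2 ∧
          HiddenClique.IsSpectralEstimate W (s.vec n) k (s'.set n)) ∧
      -- the worst-case running time is at most a constant times that of computing the
      -- principal eigenvector
      (∀ (eig : HiddenClique.Program) (n k : ℕ), k ≤ n →
        (∀ W : Matrix (Fin n) (Fin n) ℝ, HiddenClique.IsSignMatrix W →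
          HiddenClique.ComputesEigenvector k W eig) →
        ∀ T : ℕ, HiddenClique.RunsInTime n k eig T →
          HiddenClique.RunsInTime n k (eig.seq cleanup) (C * T)) ∧
      -- exact recovery with probability converging to one
      (∀ ε : ENNReal, 0 < ε → ∃ N : ℕ, ∀ n ≥ N, ∀ S : Finset (Fin n),
        100 * √(n : ℝ) < (S.card : ℝ) →
        HiddenClique.hiddenCliqueLaw S
          {W | ∃ (v : EuclideanSpace ℝ (Fin n)) (Shat : Finset (Fin n)),
            HiddenClique.IsApproxPrincipalEigenvector (1 / 100) W v ∧
            HiddenClique.IsSpectralEstimate W v S.card Shat ∧ Shat ≠ S} ≤ ε ∧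
        ∀ eig : HiddenClique.Program,
          HiddenClique.hiddenCliqueLaw S
            {W | ¬ HiddenClique.OutputsSet S.card W (eig.seq cleanup) S} ≤
          HiddenClique.hiddenCliqueLaw S
            {W | ¬ HiddenClique.ComputesEigenvector S.card W eig} + ε) := by
  -- `70 n ^ 2` steps of `cleanup` with `n ^ 2 ≤ 40 T`, plus the `T` steps of `eig`.
  refine ⟨HiddenClique.cleanup, 70 * 40 + 1, fun n k hn hk W hW s => ?_, ?_, fun ε hε => ?_⟩
  · exact (HiddenClique.haltsWithin_cleanup hn hk hW s).mono
      (Nat.mul_le_mul_right _ (by norm_num)) fun _ h => h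
  · intro eig n k hk heig T hT W hW
    -- In dimension zero there is no unit vector, so the hypothesis on `eig` cannot hold.
    rcases Nat.eq_zero_or_pos n with rfl | hn
    · obtain ⟨-, -, -, v, hv, -⟩ := heig W hW
      simpa using hv.sum_sq
    obtain ⟨t, s, he, ht⟩ := hT W hW
    obtain ⟨t', s', he', ht', -⟩ := HiddenClique.haltsWithin_cleanup hn hk hW s
    have := HiddenClique.sq_le_of_computesEigenvector heig hT
    exact ⟨t + t', s', he.seq he', by omega⟩
  · obtain ⟨N, hN⟩ := HiddenClique.exists_forall_ofReal_two_div_le hε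
    refine ⟨N + 1, fun n hn S hS => ?_⟩
    have hn0 : 0 < n := by omega
    have hfail := (HiddenClique.hiddenCliqueLaw_failure_le hn0 hS).trans (hN n (by omega))
    refine ⟨hfail, fun eig => ?_⟩
    have hk : S.card ≤ n := (Finset.card_le_univ S).trans_eq (Fintype.card_fin n)
    -- The inclusion of events holds only almost surely, since `cleanup` is guaranteed to work on
    -- sign matrices.
    refine (measure_mono_ae ?_).trans ((measure_union_le _ _).trans (add_le_add le_rfl hfail))
    filter_upwards [HiddenClique.ae_hiddenCliqueLaw S] with W hW hout
    by_contra h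
    obtain ⟨h1, h2⟩ := not_or.1 h
    obtain ⟨t, s, he, hv⟩ := not_not.1 h1
    obtain ⟨t', s', he', -, hs'⟩ := HiddenClique.haltsWithin_cleanup hn0 hk hW.1 s
    exact hout ⟨t + t', s', he.seq he', by_contra fun hne => h2 ⟨_, _, hv, hs', hne⟩⟩
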